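/- All schemes are over $\mathbb C$, a smooth variety is a smooth separated scheme of finite type over $\mathbb C$, and for $n\ge 1$ we put $Z_n=\operatorname{Spec}\,\mathbb C[t]/(t^n)$; the equation $t=0$ defines a closed immersion $U\hookrightarrow U\times Z_n$ for every scheme $U$. **(A)** Let $X$ be an irreducible smooth variety and $Y\subset X$ a smooth hypersurface, i.e. a closed subscheme, smooth over $\mathbb C$, whose ideal sheaf $\mathcal I_Y$ is locally generated by one nonzerodivisor. For $n\ge 1$ let $Y_n\subset X$ be the closed subscheme with ideal sheaf $\mathcal I_Y^n$, and for $P\in Y$ let $\mathcal O_{n,P}$ and $\mathcal O_{Y,P}$ be the local rings of $Y_n$ and $Y$ at $P$. Then for every $n\ge1$ and every $P\in Y$: 1. The restriction $r:\mathcal O_{n,P}\to\mathcal O_{Y,P}$ has a section $\sigma:\mathcal O_{Y,P}\to\mathcal O_{n,P}$ which is a homomorphism of $\mathbb C$-algebras. 2. For every such section $\sigma$ there is an isomorphism of $\mathbb C$-algebras $e:\mathcal O_{Y,P}\otimes_{\mathbb C}\mathbb C[t]/(t^n)\simeq\mathcal O_{n,P}$ with $e(a\otimes 1)=\sigma(a)$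 for all $a$, and $r(e(1\otimes t))=0$. 3. There are an open neighbourhood $U$ of $P$ in $Y$ and, if $U_n$ denotes the corresponding open subscheme of $Y_n$, an isomorphism of $\mathbb C$-schemes $U_n\simeq U\times Z_n$ whose composite with the inclusion $U\hookrightarrow U_n$ is the inclusion $U\hookrightarrow U\times Z_n$. **(B)** Let $X$ be a connected smooth variety of dimension $3$ and $Y\subset X$ a primitive multiple curve, i.e. a Cohen–Macaulay closed subscheme such that $C=Y_{\mathrm{red}}$ is a smooth connected curve and such that for every closed point $x$ of $C$ there is a surface $S\subset X$, smooth at $x$, containing a neighbourhood of $x$ in $Y$. Then there is a smallest integer $n$ with $\mathcal I_C^n\subset\mathcal I_Y$ (the multiplicity of $Y$), $n\ge 1$, and $Y$ is an abstract primitive multiple curve of multiplicity $n$ with reduced curve $C$: there are an open cover $(U_i)$ of $C$ and, for all $i,j$, an automorphism $g_{ij}$ of the $\mathbb C$-scheme $(U_i\cap U_j)\times Z_n$ inducing the identity on $U_i\cap U_j$, with $g_{jk}\circ g_{ij}=g_{ik}$ on $(U_i\cap U_j\cap U_k)\times Z_n$ for all $i,j,k$, and an isomorphism of $\mathbb C$-schemes,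 inducing the identity on $C$, from $Y$ to the scheme obtained by gluing the $U_i\times Z_n$ along the $g_{ij}$. -/

import Mathlib

open CategoryTheory CategoryTheory.Limits AlgebraicGeometry
open scoped Polynomial TensorProduct

noncomputable section

namespace PrimitiveCurves

/-! ### The base `Spec ℂ` and the fat points `Z_n = Spec ℂ[t]/(t^n)` -/

/-- The scheme `Spec ℂ`. -/
abbrev SpecC : Scheme.{0} := Spec (.of ℂ)

/-- The `ℂ`-algebra `ℂ[t]/(t^n)`. -/
abbrev TruncPoly (n : ℕ) : Type := ℂ[X] ⧸ Ideal.span {(Polynomial.X : ℂ[X]) ^ n}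

/-- The class of `t` in `ℂ[t]/(t^n)`. -/
def TruncPoly.t (n : ℕ) : TruncPoly n := Ideal.Quotient.mk _ Polynomial.X

/-- Evaluation at `t = 0`, as a ring homomorphism `ℂ[t]/(t^n) → ℂ` (for `n ≥ 1`). -/
def TruncPoly.evalZero (n : ℕ) [NeZero n] : TruncPoly n →+* ℂ :=
  Ideal.Quotient.lift _ (Polynomial.evalRingHom (0 : ℂ)) (by
    intro a ha
    obtain ⟨b, rfl⟩ := Ideal.mem_span_singleton.mp ha
    simp [NeZero.ne n])

/-- The fat point `Z_n = Spec ℂ[t]/(t^n)`. -/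
abbrev Z (n : ℕ) : Scheme.{0} := Spec (.of (TruncPoly n))

/-- The structure morphism `Z_n → Spec ℂ`. -/
def Z.str (n : ℕ) : Z n ⟶ SpecC :=
  Spec.map (CommRingCat.ofHom (algebraMap ℂ (TruncPoly n)))

/-- The closed point `Spec ℂ → Z_n`, given by `t = 0`. -/
def Z.zero (n : ℕ) [NeZero n] : SpecC ⟶ Z n :=
  Spec.map (CommRingCat.ofHom (TruncPoly.evalZero n))

lemma Z.zero_str (n : ℕ) [NeZero n] : Z.zero n ≫ Z.str n = 𝟙 _ := by
  unfold Z.zero Z.str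
  rw [← Spec.map_comp, ← CommRingCat.ofHom_comp, ← Spec.map_id]
  congr 1
  ext z
  change TruncPoly.evalZero n (algebraMap ℂ (TruncPoly n) z) = z
  change Polynomial.eval 0 (Polynomial.C z) = z
  simp

instance (n : ℕ) [NeZero n] : Surjective (Z.zero n) := by
  refine ⟨?_⟩
  have hs : Function.Surjective (TruncPoly.evalZero n) := fun z =>
    ⟨algebraMap ℂ (TruncPoly n) z, by
      change Polynomial.eval 0 (Polynomial.C z) = z
      simp⟩
  have hr := range_comap_of_surjective _ (TruncPoly.evalZero n) hs
  have hk : (RingHom.ker (TruncPoly.evalZero n) : Set (TruncPoly n)) ⊆ nilradical (TruncPoly n) := by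
    intro a ha
    obtain ⟨q, rfl⟩ := Ideal.Quotient.mk_surjective a
    have h0 : Polynomial.eval 0 q = 0 := ha
    obtain ⟨r, rfl⟩ : (Polynomial.X : ℂ[X]) ∣ q := by
      rw [Polynomial.X_dvd_iff, Polynomial.coeff_zero_eq_eval_zero, h0]
    refine mem_nilradical.mpr ⟨n, ?_⟩
    rw [← map_pow, Ideal.Quotient.eq_zero_iff_mem, mul_pow]
    exact Ideal.mul_mem_right _ _ (Ideal.mem_span_singleton_self _)
  rw [← Set.range_eq_univ]
  refine hr.trans ?_
  refine Set.eq_univ_of_forall fun p a ha => ?_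
  exact nilradical_le_prime p.asIdeal (hk ha)

/-! ### The product `C × Z_n` -/

section Product

variable {C : Scheme.{0}} (π : C ⟶ SpecC) (n : ℕ)

/-- The product `C × Z_n` over `Spec ℂ`. -/
abbrev prodZ : Scheme.{0} := pullback π (Z.str n)

/-- The projection `C × Z_n → C`. -/
abbrev prodZ.fst : prodZ π n ⟶ C := pullback.fst π (Z.str n)

/-- The structure morphism `C × Z_n → Spec ℂ`. -/
abbrev prodZ.str : prodZ π n ⟶ SpecC := prodZ.fst π n ≫ π

/-- The canonical closed immersion `C → C × Z_n`, given by `t = 0`. -/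
def prodZ.zero [NeZero n] : C ⟶ prodZ π n :=
  pullback.lift (𝟙 C) (π ≫ Z.zero n) (by simp [Z.zero_str])

lemma prodZ.isPullback_zero [NeZero n] :
    IsPullback (prodZ.zero π n) π (pullback.snd π (Z.str n)) (Z.zero n) := by
  refine IsPullback.of_right (h₁₂ := prodZ.fst π n) (h₂₂ := Z.str n) (v₁₃ := π) ?_ ?_
    (IsPullback.of_hasPullback π (Z.str n))
  · simp only [prodZ.zero, pullback.lift_fst, Z.zero_str]
    exact IsPullback.of_horiz_isIso ⟨by simp⟩
  · exact pullback.lift_snd _ _ _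

instance [NeZero n] : Surjective (prodZ.zero π n) :=
  MorphismProperty.of_isPullback (prodZ.isPullback_zero π n).flip inferInstance

/-- The open subscheme `U × Z_n` of `C × Z_n`, for `U` open in `C`. -/
abbrev prodZ.over (U : C.Opens) : Scheme.{0} := ((prodZ.fst π n) ⁻¹ᵁ U).toScheme

/-- The open immersion `W × Z_n → U × Z_n` for `W ⊆ U`. -/
abbrev prodZ.incl {W U : C.Opens} (h : W ≤ U) : prodZ.over π n W ⟶ prodZ.over π n U :=
  (prodZ π n).homOfLE (Scheme.Hom.preimage_mono _ h)

/-- The canonical closed immersion `U → U × Z_n`, given by `t = 0` (the source is `U`, written as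
the preimage of `U × Z_n` in `C`). -/
abbrev prodZ.zeroOn [NeZero n] (U : C.Opens) :
    ((prodZ.zero π n) ⁻¹ᵁ ((prodZ.fst π n) ⁻¹ᵁ U)).toScheme ⟶ prodZ.over π n U :=
  (prodZ.zero π n) ∣_ ((prodZ.fst π n) ⁻¹ᵁ U)

/-! ### The sheaf `𝒢_n` of automorphisms of `C × Z_n` inducing the identity on `C` -/

/-- The elements of `𝒢_n(U)`: automorphisms of the `ℂ`-scheme `U × Z_n` which induce the identity
on the closed subscheme `U`. -/
structure G [NeZero n] (U : C.Opens) where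
  /-- the underlying automorphism -/
  iso : prodZ.over π n U ≅ prodZ.over π n U
  over_base : iso.hom ≫ ((prodZ.fst π n) ⁻¹ᵁ U).ι ≫ prodZ.str π n =
    ((prodZ.fst π n) ⁻¹ᵁ U).ι ≫ prodZ.str π n
  fix_zero : prodZ.zeroOn π n U ≫ iso.hom = prodZ.zeroOn π n U

variable {π n} [NeZero n]

lemma G.apply {U : C.Opens} (g : G π n U) (x : prodZ.over π n U) : g.iso.hom x = x := by
  have : Surjective (prodZ.zeroOn π n U) :=
    IsZariskiLocalAtTarget.restrict (P := @Surjective) inferInstance _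
  obtain ⟨c, rfl⟩ := (prodZ.zeroOn π n U).surjective x
  rw [← Scheme.Hom.comp_apply, g.fix_zero]

lemma G.range_subset {W U : C.Opens} (g : G π n U) (h : W ≤ U) :
    Set.range (prodZ.incl π n h ≫ g.iso.hom) ⊆ Set.range (prodZ.incl π n h) := by
  rintro _ ⟨x, rfl⟩
  exact ⟨x, by rw [Scheme.Hom.comp_apply, g.apply]⟩

/-- The restriction of an element of `𝒢_n(U)` to `W × Z_n`, for `W ⊆ U`. -/
def G.res {W U : C.Opens} (g : G π n U) (h : W ≤ U) : prodZ.over π n W ⟶ prodZ.over π n W :=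
  IsOpenImmersion.lift (prodZ.incl π n h) (prodZ.incl π n h ≫ g.iso.hom) (g.range_subset h)

lemma G.res_incl {W U : C.Opens} (g : G π n U) (h : W ≤ U) :
    g.res h ≫ prodZ.incl π n h = prodZ.incl π n h ≫ g.iso.hom :=
  IsOpenImmersion.lift_fac _ _ _

lemma G.res_res {V W U : C.Opens} (g : G π n U) (h : W ≤ U) (h' : V ≤ W) :
    g.res (h'.trans h) ≫ prodZ.incl π n h' = prodZ.incl π n h' ≫ g.res h := by
  rw [← cancel_mono (prodZ.incl π n h), Category.assoc, Category.assoc, g.res_incl,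
    Scheme.homOfLE_homOfLE, Scheme.homOfLE_homOfLE_assoc, ← g.res_incl]

end Product

/-! ### Abstract primitive multiple curves -/

/-- A 1-cocycle with values in `𝒢_n` for an open cover `(U_i)` of `C`. -/
structure Cocycle {C : Scheme.{0}} (π : C ⟶ SpecC) (n : ℕ) [NeZero n] where
  /-- the indices of the cover -/
  J : Type
  /-- the members of the cover -/
  U : J → C.Opens
  iSup_U : ⨆ i, U i = ⊤
  /-- the automorphisms of the `(U_i ∩ U_j) × Z_n` -/
  g : ∀ i j, G π n (U i ⊓ U j)
  cocycle : ∀ i j k,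
    (g i j).res (W := U i ⊓ U j ⊓ U k) inf_le_left ≫
      (g j k).res (le_inf (inf_le_left.trans inf_le_right) inf_le_right) =
    (g i k).res (le_inf (inf_le_left.trans inf_le_left) inf_le_right)

namespace Cocycle

variable {C : Scheme.{0}} {π : C ⟶ SpecC} {n : ℕ} [NeZero n] (c : Cocycle π n)

lemma cocycle_res (i j k : c.J) (W : C.Opens) (hij : W ≤ c.U i ⊓ c.U j) (hjk : W ≤ c.U j ⊓ c.U k)
    (hik : W ≤ c.U i ⊓ c.U k) :
    (c.g i j).res hij ≫ (c.g j k).res hjk = (c.g i k).res hik := by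
  have hW : W ≤ c.U i ⊓ c.U j ⊓ c.U k := le_inf hij (hjk.trans inf_le_right)
  have h1 : c.U i ⊓ c.U j ⊓ c.U k ≤ c.U j ⊓ c.U k :=
    le_inf (inf_le_left.trans inf_le_right) inf_le_right
  have h2 : c.U i ⊓ c.U j ⊓ c.U k ≤ c.U i ⊓ c.U k :=
    le_inf (inf_le_left.trans inf_le_left) inf_le_right
  rw [← cancel_mono (prodZ.incl π n hW), Category.assoc, (c.g j k).res_res h1 hW,
    reassoc_of% ((c.g i j).res_res inf_le_left hW), c.cocycle, ← (c.g i k).res_res h2 hW]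

lemma g_self (i : c.J) : (c.g i i).iso.hom = 𝟙 _ := by
  have h := c.cocycle_res i i i _ le_rfl le_rfl le_rfl
  have h1 : (c.g i i).res le_rfl = (c.g i i).iso.hom := by
    have := (c.g i i).res_incl le_rfl
    simpa only [prodZ.incl, Scheme.homOfLE_rfl, Category.comp_id, Category.id_comp] using this
  rw [h1] at h
  rw [← cancel_epi (c.g i i).iso.hom, h, Category.comp_id]

lemma g_self_res (i : c.J) {W : C.Opens} (h : W ≤ c.U i ⊓ c.U i) : (c.g i i).res h = 𝟙 _ := by
  rw [← cancel_mono (prodZ.incl π n h), G.res_incl, g_self, Category.comp_id, Category.id_comp]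

lemma isPullback_incl (i j k : c.J) :
    IsPullback
      (prodZ.incl π n (inf_le_left : c.U i ⊓ c.U j ⊓ c.U k ≤ c.U i ⊓ c.U j))
      (prodZ.incl π n (le_inf (inf_le_left.trans inf_le_left) inf_le_right :
        c.U i ⊓ c.U j ⊓ c.U k ≤ c.U i ⊓ c.U k))
      (prodZ.incl π n inf_le_left) (prodZ.incl π n inf_le_left) := by
  have h := isPullback_opens_inf_le (X := prodZ π n)
    (Scheme.Hom.preimage_mono (prodZ.fst π n) (inf_le_left : c.U i ⊓ c.U j ≤ c.U i))
    (Scheme.Hom.preimage_mono (prodZ.fst π n) (inf_le_left : c.U i ⊓ c.U k ≤ c.U i))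
  refine h.of_iso (Scheme.isoOfEq _ ?_) (Iso.refl _) (Iso.refl _) (Iso.refl _) ?_ ?_ ?_ ?_
  · rw [← Scheme.Hom.preimage_inf]
    congr 1
    apply le_antisymm
    · exact le_inf inf_le_left (inf_le_right.trans inf_le_right)
    · exact le_inf inf_le_left (le_inf (inf_le_left.trans inf_le_left) inf_le_right)
  all_goals { simp [← cancel_mono (Scheme.Opens.ι _)] }

/-- The triple overlap `(U_i ∩ U_j ∩ U_k) × Z_n` as a fibre product. -/
def tripleIso (i j k : c.J) :
    pullback (prodZ.incl π n (inf_le_left : c.U i ⊓ c.U j ≤ c.U i))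
      (prodZ.incl π n (inf_le_left : c.U i ⊓ c.U k ≤ c.U i)) ≅
    prodZ.over π n (c.U i ⊓ c.U j ⊓ c.U k) :=
  (c.isPullback_incl i j k).isoPullback.symm

lemma rotate_le (i j k : c.J) : c.U i ⊓ c.U j ⊓ c.U k ≤ c.U j ⊓ c.U k ⊓ c.U i :=
  le_inf (le_inf (inf_le_left.trans inf_le_right) inf_le_right) (inf_le_left.trans inf_le_left)

lemma tripleIso_hom_incl (i j k : c.J) :
    (c.tripleIso i j k).hom ≫ prodZ.incl π n inf_le_left = pullback.fst _ _ :=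
  (c.isPullback_incl i j k).isoPullback_inv_fst

lemma tripleIso_inv_snd (i j k : c.J) :
    (c.tripleIso i j k).inv ≫ pullback.snd _ _ =
      prodZ.incl π n (le_inf (inf_le_left.trans inf_le_left) inf_le_right) :=
  (c.isPullback_incl i j k).isoPullback_hom_snd

/-- The gluing data with pieces `U_i × Z_n`, overlaps `(U_i ∩ U_j) × Z_n` and transition maps the
`g_ij`. -/
def glueData : Scheme.GlueData.{0} where
  J := c.J
  U i := prodZ.over π n (c.U i)
  V ij := prodZ.over π n (c.U ij.1 ⊓ c.U ij.2)
  f i j := prodZ.incl π n inf_le_left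
  f_open i j := inferInstance
  f_id i := by
    refine ⟨prodZ.incl π n (le_inf le_rfl le_rfl), ?_, ?_⟩ <;> simp
  t i j := (c.g i j).iso.hom ≫ prodZ.incl π n (le_of_eq (inf_comm _ _))
  t_id i := by simp [g_self]
  t' i j k := (c.tripleIso i j k).hom ≫ (c.g i j).res inf_le_left ≫
    prodZ.incl π n (c.rotate_le i j k) ≫ (c.tripleIso j k i).inv
  t_fac i j k := by
    simp only [Category.assoc, tripleIso_inv_snd, ← c.tripleIso_hom_incl i j k,
      Scheme.homOfLE_homOfLE]
    rw [← reassoc_of% ((c.g i j).res_incl), Scheme.homOfLE_homOfLE]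
  cocycle i j k := by
    have h1 : c.U i ⊓ c.U j ⊓ c.U k ≤ c.U j ⊓ c.U k :=
      le_inf (inf_le_left.trans inf_le_right) inf_le_right
    have h2 : c.U i ⊓ c.U j ⊓ c.U k ≤ c.U i ⊓ c.U k :=
      le_inf (inf_le_left.trans inf_le_left) inf_le_right
    have h3 : c.U i ⊓ c.U j ⊓ c.U k ≤ c.U k ⊓ c.U i :=
      le_inf inf_le_right (inf_le_left.trans inf_le_left)
    have h4 : c.U i ⊓ c.U j ⊓ c.U k ≤ c.U i ⊓ c.U i :=
      le_inf (inf_le_left.trans inf_le_left) (inf_le_left.trans inf_le_left)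
    have h5 : c.U i ⊓ c.U j ⊓ c.U k ≤ c.U k ⊓ c.U i ⊓ c.U j :=
      (c.rotate_le i j k).trans (c.rotate_le j k i)
    simp only [Category.assoc, Iso.inv_hom_id_assoc]
    rw [← reassoc_of% ((c.g j k).res_res inf_le_left (c.rotate_le i j k)), Scheme.homOfLE_homOfLE_assoc,
      ← reassoc_of% ((c.g k i).res_res inf_le_left h5), Scheme.homOfLE_homOfLE_assoc,
      Scheme.homOfLE_rfl, Category.id_comp]
    have e1 := c.cocycle_res i j k _ inf_le_left h1 h2
    have e2 := c.cocycle_res i k i _ h2 h3 h4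
    rw [g_self_res] at e2
    rw [reassoc_of% e1, reassoc_of% e2, Iso.hom_inv_id]

/-- The scheme `C(g)` obtained by gluing the `U_i × Z_n` along the `g_ij`: the abstract primitive
multiple curve of multiplicity `n` defined by the cocycle. -/
def glued : Scheme.{0} := c.glueData.glued

/-- The open immersion `U_i × Z_n → C(g)`. -/
def chart (i : c.J) : prodZ.over π n (c.U i) ⟶ c.glued := c.glueData.ι i

lemma str_compat (i j : c.J) :
    prodZ.incl π n (inf_le_left : c.U i ⊓ c.U j ≤ c.U i) ≫
      ((prodZ.fst π n) ⁻¹ᵁ (c.U i)).ι ≫ prodZ.str π n =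
    ((c.g i j).iso.hom ≫ prodZ.incl π n (le_of_eq (inf_comm (c.U i) (c.U j)))) ≫
      prodZ.incl π n (inf_le_left : c.U j ⊓ c.U i ≤ c.U j) ≫
      ((prodZ.fst π n) ⁻¹ᵁ (c.U j)).ι ≫ prodZ.str π n := by
  rw [Category.assoc, Scheme.homOfLE_homOfLE_assoc, Scheme.homOfLE_ι_assoc,
    Scheme.homOfLE_ι_assoc, (c.g i j).over_base]

/-- The structure morphism `C(g) → Spec ℂ`. -/
def str : c.glued ⟶ SpecC :=
  Multicoequalizer.desc c.glueData.diagram _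
    (fun i => ((prodZ.fst π n) ⁻¹ᵁ (c.U i)).ι ≫ prodZ.str π n)
    (fun ij => c.str_compat ij.1 ij.2)

lemma chart_str (i : c.J) :
    c.chart i ≫ c.str = ((prodZ.fst π n) ⁻¹ᵁ (c.U i)).ι ≫ prodZ.str π n :=
  Multicoequalizer.π_desc _ _ _ _ _

end Cocycle

/-- For a closed immersion `j : C → Y` of `ℂ`-schemes: `Y` is an abstract primitive multiple curve
of multiplicity `n` with associated reduced curve `C`, i.e. there is an isomorphism of `ℂ`-schemes
`C(g) ≅ Y` inducing the identity on `C`, for some 1-cocycle `g` with values in `𝒢_n`. -/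
def IsAbstractPrimitiveCurve {C Y : Scheme.{0}} (ρ : Y ⟶ SpecC) (j : C ⟶ Y) (n : ℕ)
    [NeZero n] : Prop :=
  ∃ (c : Cocycle (j ≫ ρ) n) (e : c.glued ≅ Y),
    e.hom ≫ ρ = c.str ∧
    ∀ i, prodZ.zeroOn (j ≫ ρ) n (c.U i) ≫ c.chart i ≫ e.hom = Scheme.Opens.ι _ ≫ j

/-! ### Local rings as `ℂ`-algebras -/

/-- The local ring `𝒪_{X,x}` of a `ℂ`-scheme `π : X → Spec ℂ`. -/
def LocalRingAt {X : Scheme.{0}} (_π : X ⟶ SpecC) (x : X) : Type := X.presheaf.stalk x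

namespace LocalRingAt

variable {X Y : Scheme.{0}} (π : X ⟶ SpecC)

instance (x : X) : CommRing (LocalRingAt π x) :=
  inferInstanceAs (CommRing (X.presheaf.stalk x))

/-- The `ℂ`-algebra structure of `𝒪_{X,x}`, induced by `π`. -/
instance (x : X) : Algebra ℂ (LocalRingAt π x) :=
  RingHom.toAlgebra (R := ℂ) (S := X.presheaf.stalk x)
    ((Scheme.ΓSpecIso (.of ℂ)).inv ≫ π.appTop ≫ X.presheaf.germ ⊤ x (TopologicalSpace.Opens.mem_top x)).hom

/-- The homomorphism of `ℂ`-algebras `𝒪_{X,f(y)} → 𝒪_{Y,y}` induced by a morphism `f : Y → X` of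
`ℂ`-schemes. -/
def comap {ρ : Y ⟶ SpecC} {π : X ⟶ SpecC} (f : Y ⟶ X) (hf : f ≫ π = ρ) (y : Y) :
    LocalRingAt π (f y) →ₐ[ℂ] LocalRingAt ρ y where
  __ := (f.stalkMap y).hom
  commutes' z := by
    subst hf
    change ((Scheme.ΓSpecIso (.of ℂ)).inv ≫ π.appTop ≫ X.presheaf.germ ⊤ (f y) (TopologicalSpace.Opens.mem_top _) ≫
      f.stalkMap y).hom z =
      ((Scheme.ΓSpecIso (.of ℂ)).inv ≫ (f ≫ π).appTop ≫ Y.presheaf.germ ⊤ y (TopologicalSpace.Opens.mem_top y)).hom z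
    congr 2
    rw [Scheme.Hom.germ_stalkMap, Scheme.Hom.comp_appTop, Category.assoc]
    rfl

end LocalRingAt

/-! ### Smooth varieties, hypersurfaces and their infinitesimal neighbourhoods -/

/-- `X` is a smooth algebraic variety over `ℂ`: smooth, separated and of finite type. -/
structure IsSmoothVariety {X : Scheme.{0}} (π : X ⟶ SpecC) : Prop where
  smooth : Smooth π
  separated : IsSeparated π
  finiteType : LocallyOfFiniteType π
  quasiCompact : QuasiCompact π

section Subschemes

variable {X : Scheme.{0}} (π : X ⟶ SpecC) (I : X.IdealSheafData) (n : ℕ)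

/-- The structure morphism to `Spec ℂ` of the closed subscheme defined by `I`. -/
abbrev subStr : I.subscheme ⟶ SpecC := I.subschemeι ≫ π

/-- The closed subscheme defined by `I` is a smooth hypersurface of `X`: it is smooth over `ℂ` and
is locally given by one equation `f = 0`, with `f` a nonzerodivisor. -/
structure IsSmoothHypersurface : Prop where
  local_equation : ∀ x : X, ∃ (U : X.affineOpens) (f : Γ(X, U.1)),
    x ∈ U.1 ∧ f ∈ nonZeroDivisors Γ(X, U.1) ∧ I.ideal U = Ideal.span {f}
  smooth : Smooth (subStr π I)

lemma pow_le [NeZero n] : I ^ n ≤ I := fun _ => Ideal.pow_le_self (NeZero.ne n)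

/-- The inclusion `Y → Y_n`, where `Y` is the closed subscheme defined by `I` and `Y_n` the one
defined by `I ^ n`. -/
abbrev thickIncl [NeZero n] : I.subscheme ⟶ (I ^ n).subscheme :=
  Scheme.IdealSheafData.inclusion (pow_le I n)

/-- The restriction homomorphism `𝒪_{n,P} → 𝒪_{Y,P}` of `ℂ`-algebras. -/
abbrev restriction [NeZero n] (P : I.subscheme) :
    LocalRingAt (subStr π (I ^ n)) (thickIncl I n P) →ₐ[ℂ] LocalRingAt (subStr π I) P :=
  LocalRingAt.comap (thickIncl I n) (by simp) P

end Subschemes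

/-! ### Primitive multiple curves -/

/-- A (Noetherian) local ring is Cohen-Macaulay if its maximal ideal contains a regular sequence
whose length is the dimension of the ring. -/
def IsCohenMacaulayLocalRing (R : Type) [CommRing R] [IsLocalRing R] : Prop :=
  IsNoetherianRing R ∧ ∃ rs : List R, (∀ r ∈ rs, r ∈ IsLocalRing.maximalIdeal R) ∧
    RingTheory.Sequence.IsRegular R rs ∧ (rs.length : WithBot ℕ∞) = ringKrullDim R

/-- The closed subscheme `Y` of `X` defined by `I` is a primitive multiple curve: `Y` is
Cohen-Macaulay, `C = Y_red` (which is defined by the radical of `I`) is a smooth connected curve,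
and for every closed point `x` of `C` there is a surface `S` in `X` (with ideal sheaf `J`),
smooth at `x`, which contains a neighbourhood of `x` in `Y`. -/
structure IsPrimitiveMultipleCurve {X : Scheme.{0}} (π : X ⟶ SpecC) (I : X.IdealSheafData) :
    Prop where
  cohenMacaulay : ∀ y : I.subscheme, IsCohenMacaulayLocalRing (I.subscheme.presheaf.stalk y)
  smooth : SmoothOfRelativeDimension 1 (subStr π I.radical)
  connected : ConnectedSpace I.radical.subscheme
  surface : ∀ x ∈ I.support, IsClosed {x} → ∃ (J : X.IdealSheafData) (W : X.Opens), x ∈ W ∧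
    SmoothOfRelativeDimension 2 ((J.subschemeι ⁻¹ᵁ W).ι ≫ subStr π J) ∧
    ∀ V : X.affineOpens, V.1 ≤ W → J.ideal V ≤ I.ideal V

/-- The multiplicity of `Y` (defined by `I`) is the smallest `n` such that `Y` is contained in the
closed subscheme defined by `I_C ^ n`, where `C = Y_red`. -/
def IsMultiplicity {X : Scheme.{0}} (I : X.IdealSheafData) (n : ℕ) : Prop :=
  IsLeast {k : ℕ | I.radical ^ k ≤ I} n

end PrimitiveCurves

end

open PrimitiveCurves

/-!
If `φ : B → A` has a section, `ker φ = (f)` and the annihilator of `f ^ (n - 1)` is `(f)`, then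
comparing the filtrations by powers of `t` and of `f` shows that `t ↦ f` identifies `A[t]/(t^n)`
with `B`. When `A` is smooth over `ℂ` and `φ` is surjective, a section exists by the infinitesimal
lifting criterion, `ker φ` being nilpotent; so wherever such a parameter `f` of `C ⊂ Y` exists,
`Y` is locally `U × Z_n`.

For `Y ⊂ Y_n` a local equation of the hypersurface is such a parameter. For a primitive multiple
curve at a closed point, the local surface and the smoothness of `C` make the maximal ideal of the
local ring of `Y` generated by some `f ∈ ker φ` and some `u` restricting to a uniformizer of `C`.
Modulo `f` every element is `0` or a unit times a power of `u`, so that `ker φ = (f)`, and an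
element outside `(f)` killing the last nonzero power of `f` would make that power be killed by
powers of every element of the maximal ideal, one of which is regular because `Y` is
Cohen–Macaulay. Parameters spread out to neighbourhoods, their order is locally constant on the
connected curve `C`, and two identifications of `Y` with `U × Z_n` differ by an automorphism which
is the identity on `U`: these automorphisms are the cocycle.
-/

namespace PrimitiveCurves

/-! ### Truncated parameters -/

/-- `f` is a parameter of `B` relative to `φ : B → A`, of order `n`: the kernel of `φ` is generated
by `f` and is the annihilator of `f ^ (n - 1)`. For surjective `φ` and `n ≠ 0` this says that `f`
behaves like `t` in `A[t]/(t^n)`. -/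
structure IsTruncatedParameter {A B : Type*} [CommRing A] [CommRing B] (φ : B →+* A) (f : B)
    (n : ℕ) : Prop where
  map_eq_zero_iff : ∀ x, φ x = 0 ↔ f ∣ x
  pow_mul_eq_zero_iff : ∀ x, f ^ (n - 1) * x = 0 ↔ f ∣ x

lemma aeval_one_tmul_surjective {R : Type*} (A : Type*) {T : Type*} [CommRing R] [CommRing A]
    [CommRing T] [Algebra R A] [Algebra R T] {t : T}
    (ht : Function.Surjective (Polynomial.aeval t : R[X] →ₐ[R] T)) :
    Function.Surjective (Polynomial.aeval (1 ⊗ₜ[R] t) : A[X] →ₐ[A] A ⊗[R] T) := by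
  intro x
  induction x using TensorProduct.induction_on with
  | zero => exact ⟨0, map_zero _⟩
  | add x y hx hy =>
    obtain ⟨⟨p, rfl⟩, ⟨q, rfl⟩⟩ := hx, hy
    exact ⟨p + q, map_add _ p q⟩
  | tmul a y =>
    obtain ⟨p, rfl⟩ := ht y
    have h_right : Polynomial.aeval (1 ⊗ₜ[R] t) p = (1 : A) ⊗ₜ[R] Polynomial.aeval t p :=
      Polynomial.aeval_algHom_apply Algebra.TensorProduct.includeRight t p
    refine ⟨Polynomial.C a * p.map (algebraMap R A), ?_⟩
    rw [map_mul, Polynomial.aeval_C, Polynomial.aeval_map_algebraMap, h_right,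
      Algebra.TensorProduct.algebraMap_apply, Algebra.TensorProduct.tmul_mul_tmul, mul_one, one_mul,
      Algebra.algebraMap_self_apply]

namespace IsTruncatedParameter

section Basic

variable {A B : Type*} [CommRing A] [CommRing B] {φ : B →+* A} {f : B} {n : ℕ}

lemma map_self (hf : IsTruncatedParameter φ f n) : φ f = 0 :=
  (hf.map_eq_zero_iff f).mpr dvd_rfl

lemma pow_pred_add_one_eq_zero (hf : IsTruncatedParameter φ f n) : f ^ (n - 1 + 1) = 0 := by
  rw [pow_succ, hf.pow_mul_eq_zero_iff]

lemma pow_eq_zero [NeZero n] (hf : IsTruncatedParameter φ f n) : f ^ n = 0 := by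
  simpa only [Nat.sub_add_cancel NeZero.one_le] using hf.pow_pred_add_one_eq_zero

lemma ker_eq_span (hf : IsTruncatedParameter φ f n) : RingHom.ker φ = Ideal.span {f} :=
  Ideal.ext fun x => (hf.map_eq_zero_iff x).trans Ideal.mem_span_singleton.symm

lemma isNilpotent_ker (hf : IsTruncatedParameter φ f n) : IsNilpotent (RingHom.ker φ) :=
  ⟨n - 1 + 1, by
    rw [hf.ker_eq_span, Ideal.span_singleton_pow, hf.pow_pred_add_one_eq_zero,
      Ideal.span_singleton_zero, Ideal.zero_eq_bot]⟩

lemma le_of_pow_eq_zero [Nontrivial A] (hf : IsTruncatedParameter φ f n) {k : ℕ}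
    (hk : f ^ k = 0) : n ≤ k := by
  by_contra! hkn
  have hpow : f ^ (n - 1) * 1 = 0 := by
    rw [mul_one]
    exact pow_eq_zero_of_le (Nat.le_sub_one_of_lt hkn) hk
  have h_one := (hf.map_eq_zero_iff 1).mpr ((hf.pow_mul_eq_zero_iff 1).mp hpow)
  exact one_ne_zero (φ.map_one ▸ h_one)

lemma dvd_of_pow_mul_eq_zero (hf : IsTruncatedParameter φ f n) {i : ℕ} (hi : i < n) {x : B}
    (hx : f ^ i * x = 0) : f ∣ x := by
  rw [← hf.pow_mul_eq_zero_iff, ← Nat.sub_add_cancel (Nat.le_sub_one_of_lt hi), pow_add, mul_assoc,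
    hx, mul_zero]

lemma of_ker_eq_span_pow {R : Type*} [CommRing R] [NeZero n] {ψ : R →+* B}
    (hψ : Function.Surjective ψ) {g : R} (hg : g ∈ nonZeroDivisors R)
    (hker : RingHom.ker ψ = Ideal.span {g ^ n})
    (hker_comp : RingHom.ker (φ.comp ψ) = Ideal.span {g}) :
    IsTruncatedParameter φ (ψ g) n := by
  have ψ_eq_zero (y : R) : ψ y = 0 ↔ g ^ n ∣ y := by
    rw [← RingHom.mem_ker, hker, Ideal.mem_span_singleton]
  have dvd_iff (y : R) : ψ g ∣ ψ y ↔ g ∣ y := by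
    refine ⟨fun ⟨z, hz⟩ => ?_, map_dvd ψ⟩
    obtain ⟨w, rfl⟩ := hψ z
    rw [← map_mul, ← sub_eq_zero, ← map_sub, ψ_eq_zero] at hz
    exact (dvd_sub_left (dvd_mul_right g w)).mp ((dvd_pow_self g (NeZero.ne n)).trans hz)
  refine ⟨hψ.forall.mpr fun y => ?_, hψ.forall.mpr fun y => ?_⟩
  · rw [dvd_iff, ← Ideal.mem_span_singleton, ← hker_comp, RingHom.mem_ker, RingHom.comp_apply]
  · rw [dvd_iff, ← map_pow, ← map_mul, ψ_eq_zero]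
    nth_rw 1 [← Nat.sub_add_cancel (NeZero.one_le (n := n)), pow_succ]
    exact dvd_cancel_left_mem_nonZeroDivisors (pow_mem hg _)

end Basic

section Section

variable {A B : Type*} [CommRing A] [CommRing B] [Algebra A B] {r : B →ₐ[A] A} {f : B} {n : ℕ}

lemma map_aeval (hf : IsTruncatedParameter (r : B →+* A) f n) (p : A[X]) :
    r (Polynomial.aeval f p) = p.coeff 0 := by
  have hrf : r f = 0 := hf.map_self
  rw [← Polynomial.aeval_algHom_apply, hrf, Polynomial.coeff_zero_eq_aeval_zero]

lemma aeval_eq_zero_iff [NeZero n] (hf : IsTruncatedParameter (r : B →+* A) f n) (p : A[X]) :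
    Polynomial.aeval f p = 0 ↔ Polynomial.X ^ n ∣ p := by
  constructor
  · intro hp
    suffices ∀ k ≤ n, Polynomial.X ^ k ∣ p from this n le_rfl
    intro k
    induction k with
    | zero => simp
    | succ k ih =>
      intro hk
      obtain ⟨q, rfl⟩ := ih (Nat.le_of_succ_le hk)
      rw [map_mul, map_pow, Polynomial.aeval_X] at hp
      have hq := (hf.map_eq_zero_iff _).mpr (hf.dvd_of_pow_mul_eq_zero hk hp)
      rw [pow_succ]
      exact mul_dvd_mul_left _ (Polynomial.X_dvd_iff.mpr ((hf.map_aeval q).symm.trans hq))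
  · rintro ⟨q, rfl⟩
    rw [map_mul, map_pow, Polynomial.aeval_X, hf.pow_eq_zero, zero_mul]

lemma aeval_surjective [NeZero n] (hf : IsTruncatedParameter (r : B →+* A) f n) :
    Function.Surjective (Polynomial.aeval f : A[X] →ₐ[A] B) := by
  intro x
  suffices ∀ k, ∃ (p : A[X]) (y : B), x = Polynomial.aeval f p + f ^ k * y by
    obtain ⟨p, y, hx⟩ := this n
    exact ⟨p, by rw [hx, hf.pow_eq_zero, zero_mul, add_zero]⟩
  intro k
  induction k with
  | zero => exact ⟨0, x, by simp⟩
  | succ k ih =>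
    obtain ⟨p, y, rfl⟩ := ih
    obtain ⟨z, hz⟩ : f ∣ y - algebraMap A B (r y) := by
      rw [← hf.map_eq_zero_iff, RingHom.coe_coe, map_sub, r.commutes, Algebra.algebraMap_self_apply,
        sub_self]
    refine ⟨p + Polynomial.C (r y) * Polynomial.X ^ k, z, ?_⟩
    rw [map_add, map_mul, map_pow, Polynomial.aeval_C, Polynomial.aeval_X]
    linear_combination f ^ k * hz

variable {R T : Type*} [CommRing R] [CommRing T] [Algebra R T]

lemma bijective_lift_of_pow_eq_zero [Algebra R A] [Algebra R B] [IsScalarTower R A B] [NeZero n]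
    (hf : IsTruncatedParameter (r : B →+* A) f n) {t : T} (ht : t ^ n = 0)
    (htop : Function.Surjective (Polynomial.aeval t : R[X] →ₐ[R] T)) {τ : T →ₐ[R] B}
    (hτ : τ t = f) :
    Function.Bijective
      (Algebra.TensorProduct.lift (Algebra.ofId A B) τ fun _ _ => Commute.all _ _) := by
  set Φ := Algebra.TensorProduct.lift (Algebra.ofId A B) τ fun _ _ => Commute.all _ _
  have Φ_aeval (p : A[X]) : Φ (Polynomial.aeval (1 ⊗ₜ t) p) = Polynomial.aeval f p := by
    rw [← Polynomial.aeval_algHom_apply]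
    simp [Φ, hτ]
  refine ⟨(injective_iff_map_eq_zero Φ).mpr ?_, fun x => ?_⟩
  · refine (aeval_one_tmul_surjective A htop).forall.mpr fun p hp => ?_
    rw [Φ_aeval, hf.aeval_eq_zero_iff] at hp
    obtain ⟨q, rfl⟩ := hp
    rw [map_mul, map_pow, Polynomial.aeval_X, Algebra.TensorProduct.tmul_pow, ht,
      TensorProduct.tmul_zero, zero_mul]
  · obtain ⟨p, rfl⟩ := hf.aeval_surjective x
    exact ⟨_, Φ_aeval p⟩

end Section

theorem exists_tensorProduct_algEquiv {R A B : Type*} [CommRing R] [CommRing A] [CommRing B]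
    [Algebra R A] [Algebra R B] {r : B →ₐ[R] A} {f : B} {n : ℕ} [NeZero n]
    (hf : IsTruncatedParameter (r : B →+* A) f n) {σ : A →ₐ[R] B} (hσ : ∀ a, r (σ a) = a) :
    ∃ e : (A ⊗[R] (R[X] ⧸ Ideal.span {(Polynomial.X : R[X]) ^ n})) ≃ₐ[R] B,
      (∀ a, e (a ⊗ₜ 1) = σ a) ∧ e (1 ⊗ₜ Ideal.Quotient.mk _ Polynomial.X) = f := by
  algebraize [(σ : A →+* B)]
  have : IsScalarTower R A B := .of_algebraMap_eq fun z => (σ.commutes z).symm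
  let rA : B →ₐ[A] A := { (r : B →+* A) with commutes' := hσ }
  let I := Ideal.span {(Polynomial.X : R[X]) ^ n}
  let τ : (R[X] ⧸ I) →ₐ[R] B := Ideal.Quotient.liftₐ I (Polynomial.aeval f) fun p hp => by
    obtain ⟨q, rfl⟩ := Ideal.mem_span_singleton.mp hp
    rw [map_mul, map_pow, Polynomial.aeval_X, hf.pow_eq_zero, zero_mul]
  have hτ : τ (Ideal.Quotient.mk I Polynomial.X) = f := Polynomial.aeval_X f
  have t_pow : Ideal.Quotient.mk I Polynomial.X ^ n = 0 := by
    rw [← map_pow, Ideal.Quotient.eq_zero_iff_mem]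
    exact Ideal.mem_span_singleton_self _
  have aeval_t : (Polynomial.aeval (Ideal.Quotient.mk I Polynomial.X) : R[X] →ₐ[R] _) =
      Ideal.Quotient.mkₐ R I := by
    ext
    simp
  have hfA : IsTruncatedParameter (rA : B →+* A) f n := hf
  let Φ : (A ⊗[R] (R[X] ⧸ I)) →ₐ[A] B :=
    Algebra.TensorProduct.lift (Algebra.ofId A B) τ fun _ _ => Commute.all _ _
  have Φ_tmul (a : A) (y : R[X] ⧸ I) : Φ (a ⊗ₜ y) = σ a * τ y :=
    Algebra.TensorProduct.lift_tmul _ _ _ a y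
  have h_bij : Function.Bijective Φ :=
    hfA.bijective_lift_of_pow_eq_zero t_pow (aeval_t ▸ Ideal.Quotient.mkₐ_surjective R I) hτ
  refine ⟨(AlgEquiv.ofBijective Φ h_bij).restrictScalars R, fun a => (Φ_tmul a 1).trans ?_,
    (Φ_tmul 1 _).trans ?_⟩
  · rw [map_one, mul_one]
  · rw [map_one, one_mul, hτ]

end IsTruncatedParameter

/-! ### Localization of truncated parameters -/

section Localization

lemma IsTruncatedParameter.of_associated {A B : Type*} [CommRing A] [CommRing B] {φ : B →+* A}
    {f g : B} {n : ℕ} (hf : IsTruncatedParameter φ f n) (hfg : Associated f g) :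
    IsTruncatedParameter φ g n where
  map_eq_zero_iff x := (hf.map_eq_zero_iff x).trans hfg.dvd_iff_dvd_left
  pow_mul_eq_zero_iff x := by
    rw [← hfg.dvd_iff_dvd_left, ← hf.pow_mul_eq_zero_iff]
    exact ((hfg.pow_pow (n := n - 1)).mul_right x).eq_zero_iff.symm

/-- `f` becomes a parameter of order `n` relative to `φ` once the elements of `M` are inverted,
see `isTruncatedParameter_algebraMap_iff`. -/
def IsTruncatedParameterAwayFrom {A B : Type*} [CommRing A] [CommRing B] (M : Submonoid B)
    (φ : B →+* A) (f : B) (n : ℕ) : Prop :=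
  ∀ x, ((∃ s ∈ M, φ (s * x) = 0) ↔ ∃ s ∈ M, f ∣ s * x) ∧
    ((∃ s ∈ M, f ^ (n - 1) * (s * x) = 0) ↔ ∃ s ∈ M, f ∣ s * x)

section IsLocalization

variable {B : Type*} [CommRing B] (M : Submonoid B) {B' : Type*} [CommRing B']
  [Algebra B B'] [IsLocalization M B']

variable (B') in
lemma algebraMap_eq_zero_iff_exists_mem (x : B) : algebraMap B B' x = 0 ↔ ∃ s ∈ M, s * x = 0 := by
  rw [IsLocalization.map_eq_zero_iff M]
  exact ⟨fun ⟨s, hs⟩ => ⟨s, s.2, hs⟩, fun ⟨s, hs, hsx⟩ => ⟨⟨s, hs⟩, hsx⟩⟩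

variable (B') in
lemma algebraMap_dvd_algebraMap_iff (f x : B) :
    algebraMap B B' f ∣ algebraMap B B' x ↔ ∃ s ∈ M, f ∣ s * x := by
  rw [← Ideal.mem_span_singleton, ← Set.image_singleton, ← Ideal.map_span,
    IsLocalization.algebraMap_mem_map_algebraMap_iff M]
  simp only [Ideal.mem_span_singleton]

include M in
lemma exists_associated_algebraMap (x : B') : ∃ y : B, Associated x (algebraMap B B' y) := by
  obtain ⟨⟨y, s⟩, hy⟩ := IsLocalization.surj M x
  exact ⟨y, (IsLocalization.map_units B' s).unit, hy⟩

variable {A A' : Type*} [CommRing A] [CommRing A'] [Algebra A A'] {φ : B →+* A} {φ' : B' →+* A'}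
  [IsLocalization (M.map φ) A'] {f : B} {n : ℕ}

lemma isTruncatedParameter_algebraMap_iff
    (hφ : ∀ x, φ' (algebraMap B B' x) = algebraMap A A' (φ x)) :
    IsTruncatedParameter φ' (algebraMap B B' f) n ↔ IsTruncatedParameterAwayFrom M φ f n := by
  have map_iff (x : B) : φ' (algebraMap B B' x) = 0 ↔ ∃ s ∈ M, φ (s * x) = 0 := by
    simp only [hφ, algebraMap_eq_zero_iff_exists_mem (M.map φ) A', Submonoid.mem_map,
      exists_exists_and_eq_and, map_mul]
  have pow_iff (x : B) : algebraMap B B' f ^ (n - 1) * algebraMap B B' x = 0 ↔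
      ∃ s ∈ M, f ^ (n - 1) * (s * x) = 0 := by
    simp only [← map_pow, ← map_mul, algebraMap_eq_zero_iff_exists_mem M B',
      mul_left_comm]
  refine ⟨fun hf x => ?_, fun h => ⟨fun x => ?_, fun x => ?_⟩⟩
  · rw [← map_iff, ← pow_iff, ← algebraMap_dvd_algebraMap_iff M B']
    exact ⟨hf.map_eq_zero_iff _, hf.pow_mul_eq_zero_iff _⟩
  all_goals obtain ⟨y, hxy⟩ := exists_associated_algebraMap M x
  · rw [(hxy.map φ').eq_zero_iff, hxy.dvd_iff_dvd_right, map_iff,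
      algebraMap_dvd_algebraMap_iff M]
    exact (h y).1
  · rw [(hxy.mul_left _).eq_zero_iff, hxy.dvd_iff_dvd_right, pow_iff,
      algebraMap_dvd_algebraMap_iff M]
    exact (h y).2

lemma exists_isTruncatedParameterAwayFrom
    (hφ : ∀ x, φ' (algebraMap B B' x) = algebraMap A A' (φ x)) {f' : B'}
    (hf' : IsTruncatedParameter φ' f' n) : ∃ f, IsTruncatedParameterAwayFrom M φ f n := by
  obtain ⟨f, hf⟩ := exists_associated_algebraMap M f'
  exact ⟨f, (isTruncatedParameter_algebraMap_iff M hφ).mp (hf'.of_associated hf)⟩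

include M in
lemma isNilpotent_of_map_eq_zero_of_isLocalization
    (hφ : ∀ x, φ' (algebraMap B B' x) = algebraMap A A' (φ x))
    (h_nil : ∀ x, φ x = 0 → IsNilpotent x) {x : B'} (hx : φ' x = 0) : IsNilpotent x := by
  obtain ⟨y, u, hy⟩ := exists_associated_algebraMap M x
  obtain ⟨_, ⟨s, hs, rfl⟩, hsy⟩ := (algebraMap_eq_zero_iff_exists_mem (M.map φ) A' (φ y)).mp <| by
    rw [← hφ, ← hy, map_mul, hx, zero_mul]
  have h_unit : IsUnit (algebraMap B B' s) := IsLocalization.map_units B' (⟨s, hs⟩ : M)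
  have h_mul : IsNilpotent (algebraMap B B' s * (x * u)) := by
    rw [hy, ← map_mul]
    exact (h_nil (s * y) (by rwa [map_mul])).map _
  rwa [h_unit.isNilpotent_unit_mul_of_commute_iff (.all _ _),
    u.isUnit.isNilpotent_mul_unit_of_commute_iff (.all _ _)] at h_mul

end IsLocalization

variable {A B : Type*} [CommRing A] [CommRing B] {φ : B →+* A} {M : Submonoid B} {f : B} {n : ℕ}

lemma IsTruncatedParameter.awayFrom (hf : IsTruncatedParameter φ f n) (M : Submonoid B) :
    IsTruncatedParameterAwayFrom M φ f n := fun x => by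
  simp only [hf.map_eq_zero_iff, hf.pow_mul_eq_zero_iff, and_self]

lemma exists_mem_forall_mul_mem {K J : Ideal B} (hK : K.FG) (h : ∀ x ∈ K, ∃ s ∈ M, s * x ∈ J) :
    ∃ g ∈ M, ∀ x ∈ K, g * x ∈ J := by
  classical
  obtain ⟨S, rfl⟩ := hK
  choose! s hsM hsJ using h
  refine ⟨∏ y ∈ S, s y, prod_mem fun y hy => hsM y (Ideal.subset_span hy), fun x hx => ?_⟩
  have h_le : Ideal.span (S : Set B) ≤ J.colon {∏ y ∈ S, s y} := by
    refine Ideal.span_le.mpr fun y hy => Submodule.mem_colon_singleton.mpr ?_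
    rw [smul_eq_mul, mul_comm, ← Finset.prod_erase_mul S s hy, mul_assoc]
    exact J.mul_mem_left _ (hsJ y (Ideal.subset_span hy))
  simpa only [smul_eq_mul, mul_comm] using Submodule.mem_colon_singleton.mp (h_le hx)

lemma exists_mem_forall_dvd_exists_powers [IsNoetherianRing B] {K J : Ideal B}
    (hKJ : ∀ x, (∃ s ∈ M, s * x ∈ K) ↔ ∃ s ∈ M, s * x ∈ J) :
    ∃ g ∈ M, ∀ h, g ∣ h → ∀ x, (∃ s ∈ Submonoid.powers h, s * x ∈ K) ↔
      ∃ s ∈ Submonoid.powers h, s * x ∈ J := by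
  obtain ⟨g₁, hg₁, h₁⟩ := exists_mem_forall_mul_mem K.fg_of_isNoetherianRing fun x hx =>
    (hKJ x).mp ⟨1, one_mem M, (one_mul x).symm ▸ hx⟩
  obtain ⟨g₂, hg₂, h₂⟩ := exists_mem_forall_mul_mem J.fg_of_isNoetherianRing fun x hx =>
    (hKJ x).mpr ⟨1, one_mem M, (one_mul x).symm ▸ hx⟩
  refine ⟨g₁ * g₂, mul_mem hg₁ hg₂, ?_⟩
  rintro _ ⟨c, rfl⟩ x
  constructor <;> rintro ⟨s, hs, hsx⟩ <;>
    refine ⟨_, mul_mem (Submonoid.mem_powers (g₁ * g₂ * c)) hs, ?_⟩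
  · convert J.mul_mem_left (g₂ * c) (h₁ _ hsx) using 1
    ring
  · convert K.mul_mem_left (g₁ * c) (h₂ _ hsx) using 1
    ring

lemma IsTruncatedParameterAwayFrom.exists_powers [IsNoetherianRing B]
    (hf : IsTruncatedParameterAwayFrom M φ f n) :
    ∃ g ∈ M, IsTruncatedParameterAwayFrom (Submonoid.powers g) φ f n := by
  have mem_ker (x : B) : x ∈ RingHom.ker φ ↔ φ x = 0 := .rfl
  have mem_ann (x : B) :
      x ∈ LinearMap.ker (LinearMap.mulLeft B (f ^ (n - 1))) ↔ f ^ (n - 1) * x = 0 := .rfl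
  simp only [IsTruncatedParameterAwayFrom, ← mem_ker, ← mem_ann, ← Ideal.mem_span_singleton] at hf ⊢
  obtain ⟨g₁, hg₁, h₁⟩ := exists_mem_forall_dvd_exists_powers fun x => (hf x).1
  obtain ⟨g₂, hg₂, h₂⟩ := exists_mem_forall_dvd_exists_powers fun x => (hf x).2
  exact ⟨g₁ * g₂, mul_mem hg₁ hg₂, fun x =>
    ⟨h₁ _ (dvd_mul_right g₁ g₂) x, h₂ _ (dvd_mul_left g₂ g₁) x⟩⟩

end Localization

/-! ### Truncated parameters of local rings -/

section LocalRing

open IsLocalRing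

lemma dvd_or_dvd_of_span_pair_eq_span_singleton {A : Type*} [CommRing A] [IsLocalRing A]
    {x y t : A} (h : Ideal.span {x, y} = Ideal.span {t}) : x ∣ y ∨ y ∣ x := by
  obtain ⟨a, rfl⟩ : t ∣ x := by
    rw [← Ideal.mem_span_singleton, ← h]
    exact Ideal.subset_span (Set.mem_insert _ _)
  obtain ⟨b, rfl⟩ : t ∣ y := by
    rw [← Ideal.mem_span_singleton, ← h]
    exact Ideal.subset_span (Set.mem_insert_of_mem _ rfl)
  obtain ⟨c, d, hcd⟩ := Ideal.mem_span_pair.mp (h ▸ Ideal.mem_span_singleton_self t)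
  have h_ann : t * (1 - (c * a + d * b)) = 0 := by linear_combination -hcd
  rcases isUnit_or_isUnit_one_sub_self (c * a + d * b) with h_unit | h_unit
  · rcases isUnit_or_isUnit_of_isUnit_add h_unit with h_unit | h_unit
    · exact .inl (mul_dvd_mul_left t (isUnit_of_mul_isUnit_right h_unit).dvd)
    · exact .inr (mul_dvd_mul_left t (isUnit_of_mul_isUnit_right h_unit).dvd)
  · rw [h_unit.mul_left_eq_zero.mp h_ann, zero_mul, zero_mul]
    exact .inl dvd_rfl

lemma exists_maximalIdeal_eq_span_pair_map_eq_zero {A B : Type*} [CommRing A] [IsLocalRing A]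
    [CommRing B] [IsLocalRing B] {φ : B →+* A} (hφ : Function.Surjective φ) {u v : B} {t : A}
    (hB : maximalIdeal B = Ideal.span {u, v}) (hA : maximalIdeal A = Ideal.span {t}) :
    ∃ u f : B, maximalIdeal B = Ideal.span {u, f} ∧ φ f = 0 := by
  have of_dvd {u v : B} (hB : maximalIdeal B = Ideal.span {u, v}) (huv : φ u ∣ φ v) :
      ∃ u f : B, maximalIdeal B = Ideal.span {u, f} ∧ φ f = 0 := by
    obtain ⟨s, hs⟩ := huv
    obtain ⟨s, rfl⟩ := hφ s
    refine ⟨u, v + -s * u, by rw [Ideal.span_pair_add_mul_left, hB], ?_⟩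
    rw [map_add, map_mul, map_neg, hs]
    ring
  have : IsLocalHom φ := hφ.isLocalHom
  have h_span : Ideal.span {φ u, φ v} = Ideal.span {t} := by
    rw [← hA, ← map_maximalIdeal_of_surjective φ hφ, hB, Ideal.map_span, Set.image_pair]
  rcases dvd_or_dvd_of_span_pair_eq_span_singleton h_span with huv | hvu
  · exact of_dvd hB huv
  · exact of_dvd (hB.trans (by rw [Set.pair_comm])) hvu

lemma eq_zero_or_exists_eq_mul_pow {B : Type*} [CommRing B] [IsLocalRing B] [IsNoetherianRing B]
    {u : B} (hu : maximalIdeal B = Ideal.span {u}) (x : B) :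
    x = 0 ∨ ∃ w k, IsUnit w ∧ x = w * u ^ k := by
  by_contra! h
  refine h.1 ?_
  rw [← Ideal.mem_bot, ← Ideal.iInf_pow_eq_bot_of_isLocalRing _ (maximalIdeal.isMaximal B).ne_top,
    Ideal.mem_iInf]
  intro k
  rw [hu, Ideal.span_singleton_pow, Ideal.mem_span_singleton]
  induction k with
  | zero => exact pow_zero u ▸ one_dvd x
  | succ k ih =>
    obtain ⟨w, rfl⟩ := ih
    have hw : w ∈ maximalIdeal B := fun hw => h.2 w k hw (mul_comm _ _)
    rw [hu, Ideal.mem_span_singleton] at hw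
    exact pow_succ u k ▸ mul_dvd_mul_left _ hw

lemma dvd_or_exists_dvd_sub_mul_pow {B : Type*} [CommRing B] [IsLocalRing B] [IsNoetherianRing B]
    {u f : B} (huf : maximalIdeal B = Ideal.span {u, f}) (x : B) :
    f ∣ x ∨ ∃ w k, IsUnit w ∧ f ∣ x - w * u ^ k := by
  have hf : f ∈ maximalIdeal B := huf ▸ Ideal.subset_span (by simp)
  let π := Ideal.Quotient.mk (Ideal.span {f})
  have : Nontrivial (B ⧸ Ideal.span {f}) :=
    Ideal.Quotient.nontrivial_iff.mpr ((Ideal.span_singleton_eq_top).not.mpr hf)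
  have : IsLocalRing (B ⧸ Ideal.span {f}) := .of_surjective' π Ideal.Quotient.mk_surjective
  have : IsLocalHom π := .of_surjective π Ideal.Quotient.mk_surjective
  have π_eq_zero_iff (y : B) : π y = 0 ↔ f ∣ y :=
    Ideal.Quotient.eq_zero_iff_mem.trans Ideal.mem_span_singleton
  have hu : maximalIdeal (B ⧸ Ideal.span {f}) = Ideal.span {π u} := by
    rw [← map_maximalIdeal_of_surjective π Ideal.Quotient.mk_surjective, huf, Ideal.map_span,
      Set.image_pair, (π_eq_zero_iff f).mpr dvd_rfl, Set.pair_comm, Ideal.span_insert_zero]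
  rcases eq_zero_or_exists_eq_mul_pow hu (π x) with h | ⟨w, k, hw, h⟩
  · exact .inl ((π_eq_zero_iff x).mp h)
  · obtain ⟨w, rfl⟩ := Ideal.Quotient.mk_surjective w
    refine .inr ⟨w, k, isUnit_of_map_unit π w hw, ?_⟩
    rw [← π_eq_zero_iff, map_sub, h, map_mul, map_pow, sub_self]

section Parameter

variable {A B : Type*} [CommRing A] [CommRing B] [IsLocalRing B] [IsNoetherianRing B]

lemma map_eq_zero_iff_dvd_of_maximalIdeal_eq_span_pair [Nontrivial A] {φ : B →+* A} {u f : B}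
    (huf : maximalIdeal B = Ideal.span {u, f}) (hf : φ f = 0) (hu : ¬IsNilpotent (φ u)) (x : B) :
    φ x = 0 ↔ f ∣ x := by
  refine ⟨fun hx => ?_, fun h => zero_dvd_iff.mp (hf ▸ map_dvd φ h)⟩
  rcases dvd_or_exists_dvd_sub_mul_pow huf x with h | ⟨w, k, hw, h⟩
  · exact h
  · have h_zero := zero_dvd_iff.mp (hf ▸ map_dvd φ h)
    rw [map_sub, hx, zero_sub, neg_eq_zero, map_mul, map_pow,
      (hw.map φ).mul_right_eq_zero] at h_zero
    exact absurd ⟨k, h_zero⟩ hu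

lemma pow_pred_nilpotencyClass_mul_eq_zero_iff {u f r : B}
    (huf : maximalIdeal B = Ideal.span {u, f}) (hf : IsNilpotent f) (hr : r ∈ maximalIdeal B)
    (hreg : IsSMulRegular B r) (x : B) : f ^ (nilpotencyClass f - 1) * x = 0 ↔ f ∣ x := by
  have pow_mul_self : f ^ (nilpotencyClass f - 1) * f = 0 := by
    rw [← pow_succ, Nat.sub_add_cancel (pos_nilpotencyClass_iff.mpr hf), pow_nilpotencyClass hf]
  have pow_mul_eq_zero {y : B} (h : f ∣ y) : f ^ (nilpotencyClass f - 1) * y = 0 := by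
    obtain ⟨y, rfl⟩ := h
    rw [← mul_assoc, pow_mul_self, zero_mul]
  refine ⟨fun hx => ?_, pow_mul_eq_zero⟩
  rcases dvd_or_exists_dvd_sub_mul_pow huf x with h | ⟨w, k, hw, h⟩
  · exact h
  obtain ⟨a, b, rfl⟩ := Ideal.mem_span_pair.mp (huf ▸ hr)
  have pow_mul_pow_u : f ^ (nilpotencyClass f - 1) * u ^ k = 0 := by
    have := pow_mul_eq_zero h
    rw [mul_sub, hx, zero_sub, neg_eq_zero, mul_left_comm, hw.mul_right_eq_zero] at this
    exact this
  have pow_mul_pow_r : f ^ (nilpotencyClass f - 1) * (a * u + b * f) ^ k = 0 := by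
    have h_dvd : f ∣ (a * u + b * f) ^ k - (a * u) ^ k :=
      Dvd.dvd.trans ⟨b, by ring⟩ (sub_dvd_pow_sub_pow _ _ k)
    linear_combination pow_mul_eq_zero h_dvd + a ^ k * pow_mul_pow_u
  have pow_eq_zero : f ^ (nilpotencyClass f - 1) = 0 :=
    (hreg.pow k).right_eq_zero_of_smul ((mul_comm _ _).trans pow_mul_pow_r)
  exact absurd pow_eq_zero (pow_pred_nilpotencyClass hf)

end Parameter

theorem exists_isTruncatedParameter_of_isLocalRing {A B : Type*} [CommRing A] [CommRing B]
    [IsLocalRing A] [IsLocalRing B] [IsNoetherianRing B] {φ : B →+* A}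
    (hφ : Function.Surjective φ) (hker : ∀ x, φ x = 0 → IsNilpotent x) {t : A}
    (ht : maximalIdeal A = Ideal.span {t}) (ht_nil : ¬IsNilpotent t) {u v : B}
    (huv : maximalIdeal B = Ideal.span {u, v}) {r : B} (hr : r ∈ maximalIdeal B)
    (hreg : IsSMulRegular B r) : ∃ f n, n ≠ 0 ∧ IsTruncatedParameter φ f n := by
  obtain ⟨u, f, huf, hf⟩ := exists_maximalIdeal_eq_span_pair_map_eq_zero hφ huv ht
  have hu : ¬IsNilpotent (φ u) := by
    have : IsLocalHom φ := hφ.isLocalHom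
    have h_span : Ideal.span {t} = Ideal.span {φ u} := by
      rw [← ht, ← map_maximalIdeal_of_surjective φ hφ, huf, Ideal.map_span, Set.image_pair, hf,
        Set.pair_comm, Ideal.span_insert_zero]
    obtain ⟨c, rfl⟩ := Ideal.mem_span_singleton.mp (h_span ▸ Ideal.mem_span_singleton_self t)
    exact fun h => ht_nil ((Commute.all _ _).isNilpotent_mul_right h)
  exact ⟨f, nilpotencyClass f, (pos_nilpotencyClass_iff.mpr (hker f hf)).ne',
    map_eq_zero_iff_dvd_of_maximalIdeal_eq_span_pair huf hf hu,
    pow_pred_nilpotencyClass_mul_eq_zero_iff huf (hker f hf) hr hreg⟩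

lemma IsCohenMacaulayLocalRing.exists_isSMulRegular {B : Type} [CommRing B] [IsLocalRing B]
    (h : IsCohenMacaulayLocalRing B) {u : B} (hu : u ∈ maximalIdeal B)
    (hu_nil : ¬IsNilpotent u) : ∃ r ∈ maximalIdeal B, IsSMulRegular B r := by
  obtain ⟨-, rs, hrs, hreg, hdim⟩ := h
  cases rs with
  | nil =>
    have : Ring.KrullDimLE 0 B := by
      rw [Ring.krullDimLE_iff, ← hdim, List.length_nil, Nat.cast_zero]
    exact absurd (Ring.KrullDimLE.isNilpotent_iff_mem_maximalIdeal.mpr hu) hu_nil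
  | cons r rs =>
    exact ⟨r, hrs r List.mem_cons_self,
      ((RingTheory.Sequence.isRegular_cons_iff _ _ _).mp hreg).1⟩

end LocalRing

section StandardSmooth

open MvPolynomial

lemma sub_C_eval_mem_span_range_X_sub_C {R ι : Type*} [CommRing R] (c : ι → R)
    (p : MvPolynomial ι R) :
    p - C (eval c p) ∈ Ideal.span (Set.range fun i => (X i - C (c i) : MvPolynomial ι R)) := by
  rw [← Ideal.Quotient.eq]
  set I := Ideal.span (Set.range fun i => (X i - C (c i) : MvPolynomial ι R))
  have h_mk : Ideal.Quotient.mk I = ((Ideal.Quotient.mk I).comp C).comp (eval c) := by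
    refine MvPolynomial.ringHom_ext (fun r => by simp only [RingHom.comp_apply, eval_C])
      fun i => ?_
    rw [RingHom.comp_apply, RingHom.comp_apply, eval_X, Ideal.Quotient.eq]
    exact Ideal.subset_span ⟨i, rfl⟩
  exact congr($h_mk p)

lemma vanishingIdeal_singleton_eq_span {K ι : Type*} [Field K] (c : ι → K) :
    vanishingIdeal K {c} =
      Ideal.span (Set.range fun i => (X i - C (c i) : MvPolynomial ι K)) := by
  refine le_antisymm (fun p hp => ?_) ?_
  · rw [mem_vanishingIdeal_singleton_iff, aeval_eq_eval] at hp
    simpa only [RingHom.coe_coe, hp, map_zero, sub_zero] using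
      sub_C_eval_mem_span_range_X_sub_C c p
  · rw [Ideal.span_le]
    rintro _ ⟨i, rfl⟩
    simp

lemma isSMulRegular_X_sub_C {R ι : Type*} [CommRing R] [IsDomain R] (i : ι) (c : R) :
    IsSMulRegular (MvPolynomial ι R) (X i - C c : MvPolynomial ι R) := by
  refine (IsRegular.of_ne_zero fun h => ?_).left
  simpa using congrArg (eval fun _ => c + 1) h

lemma isMaximal_comap_of_finiteType {P S : Type*} [CommRing P] [IsJacobsonRing P] [CommRing S]
    [Algebra P S] [Algebra.FiniteType P S] (q : Ideal S) [q.IsMaximal] :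
    (q.comap (algebraMap P S)).IsMaximal := by
  let := Ideal.Quotient.field q
  have : Module.Finite P (S ⧸ q) := finite_of_finite_type_of_isJacobsonRing P (S ⧸ q)
  have h_ker : RingHom.ker (algebraMap P (S ⧸ q)) = q.comap (algebraMap P S) := by
    rw [IsScalarTower.algebraMap_eq P S (S ⧸ q), ← RingHom.comap_ker,
      Ideal.Quotient.algebraMap_eq, Ideal.mk_ker]
  exact h_ker ▸ Ideal.isMaximal_comap_of_isIntegral_of_isMaximal (⊥ : Ideal (S ⧸ q))

lemma maximalIdeal_eq_map_of_etale {P S L : Type*} [CommRing P] [CommRing S] [Algebra P S]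
    [Algebra.Etale P S] [CommRing L] [IsLocalRing L] [Algebra S L] (q : Ideal S) [q.IsPrime]
    [IsLocalization.AtPrime L q] :
    IsLocalRing.maximalIdeal L =
      (q.comap (algebraMap P S)).map ((algebraMap S L).comp (algebraMap P S)) := by
  have : (q.comap (algebraMap P S)).IsPrime := Ideal.comap_isPrime _ q
  have : q.LiesOver (q.comap (algebraMap P S)) := ⟨rfl⟩
  let := Localization.AtPrime.algebraOfLiesOver (q.comap (algebraMap P S)) q
  let e : Localization.AtPrime q ≃ₐ[S] L := IsLocalization.algEquiv q.primeCompl _ _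
  have h_map := ((Algebra.isUnramifiedAt_iff_map_eq P (q.comap (algebraMap P S)) q).mp
    (inferInstanceAs (Algebra.FormallyUnramified _ _))).2
  have h_equiv := IsLocalRing.map_ringEquiv_maximalIdeal e.toRingEquiv
  rw [← h_map] at h_equiv
  rw [← h_equiv]
  refine (Ideal.map_map _ e.toRingEquiv.toRingHom).trans ?_
  congr 1
  ext x
  change e (algebraMap _ (Localization.AtPrime q) _) = _
  rw [IsScalarTower.algebraMap_apply P S (Localization.AtPrime q)]
  exact e.commutes _

theorem exists_maximalIdeal_eq_span_of_isStandardSmooth {K S L : Type*} [Field K] [IsAlgClosed K]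
    [CommRing S] {f : K →+* S} {d : ℕ} (hf : f.IsStandardSmoothOfRelativeDimension d)
    (q : Ideal S) [q.IsMaximal] [CommRing L] [IsLocalRing L] [Algebra S L]
    [IsLocalization.AtPrime L q] :
    ∃ x : Fin d → L, IsLocalRing.maximalIdeal L = Ideal.span (Set.range x) ∧
      ∀ i, IsSMulRegular L (x i) := by
  obtain ⟨g, -, hg⟩ := hf.exists_etale_mvPolynomial
  algebraize [g]
  obtain ⟨c, hc⟩ := isMaximal_iff_eq_vanishingIdeal_singleton.mp
    (isMaximal_comap_of_finiteType (P := MvPolynomial (Fin d) K) q)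
  refine ⟨fun i => algebraMap S L (g (X i - C (c i))), ?_, fun i => ?_⟩
  · rw [maximalIdeal_eq_map_of_etale (P := MvPolynomial (Fin d) K) q, hc,
      vanishingIdeal_singleton_eq_span, Ideal.map_span, ← Set.range_comp]
    rfl
  · have : Module.Flat S L := IsLocalization.flat L q.primeCompl
    exact ((isSMulRegular_X_sub_C i (c i)).of_flat (S := S)).of_flat (S := L)

end StandardSmooth

/-! ### Gluing charts -/

noncomputable section Gluing

variable {C : Scheme.{0}} {π : C ⟶ SpecC} {n : ℕ} [NeZero n]

lemma prodZ.zero_fst : prodZ.zero π n ≫ prodZ.fst π n = 𝟙 C := pullback.lift_fst _ _ _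

lemma prodZ.zero_preimage_fst_preimage (U : C.Opens) :
    (prodZ.zero π n) ⁻¹ᵁ ((prodZ.fst π n) ⁻¹ᵁ U) = U := by
  rw [← Scheme.Hom.comp_preimage, prodZ.zero_fst]
  rfl

instance (U : C.Opens) : Surjective (prodZ.zeroOn π n U) :=
  IsZariskiLocalAtTarget.restrict (P := @Surjective) inferInstance _

lemma prodZ.zeroOn_incl {W U : C.Opens} (h : W ≤ U) :
    prodZ.zeroOn π n W ≫ prodZ.incl π n h =
      C.homOfLE (Scheme.Hom.preimage_mono _ (Scheme.Hom.preimage_mono _ h)) ≫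
        prodZ.zeroOn π n U := by
  rw [← cancel_mono (Scheme.Opens.ι _)]
  simp

namespace Cocycle

variable (c : Cocycle π n)

lemma chart_condition (i k : c.J) :
    prodZ.incl π n (inf_le_left : c.U i ⊓ c.U k ≤ c.U i) ≫ c.chart i =
      (c.g i k).iso.hom ≫ prodZ.incl π n inf_le_right ≫ c.chart k := by
  have h := c.glueData.glue_condition i k
  change ((c.g i k).iso.hom ≫ prodZ.incl π n (le_of_eq (inf_comm (c.U i) (c.U k)))) ≫
    prodZ.incl π n (inf_le_left : c.U k ⊓ c.U i ≤ c.U k) ≫ c.chart k =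
    prodZ.incl π n inf_le_left ≫ c.chart i at h
  rw [← h, Category.assoc, Scheme.homOfLE_homOfLE_assoc]

variable {Y : Scheme.{0}}

lemma glued_hom_ext {f f' : c.glued ⟶ Y} (h : ∀ i, c.chart i ≫ f = c.chart i ≫ f') : f = f' :=
  Multicoequalizer.hom_ext _ _ _ h

lemma exists_chart_comp_eq (b : ∀ i, prodZ.over π n (c.U i) ⟶ Y)
    (hb : ∀ i k, prodZ.incl π n (inf_le_left : c.U i ⊓ c.U k ≤ c.U i) ≫ b i =
      (c.g i k).iso.hom ≫ prodZ.incl π n inf_le_right ≫ b k) :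
    ∃ f : c.glued ⟶ Y, ∀ i, c.chart i ≫ f = b i := by
  have hb' (i k : c.J) : prodZ.incl π n (inf_le_left : c.U i ⊓ c.U k ≤ c.U i) ≫ b i =
      ((c.g i k).iso.hom ≫ prodZ.incl π n (le_of_eq (inf_comm (c.U i) (c.U k)))) ≫
        prodZ.incl π n (inf_le_left : c.U k ⊓ c.U i ≤ c.U k) ≫ b k := by
    rw [hb, Category.assoc, Scheme.homOfLE_homOfLE_assoc]
  exact ⟨Multicoequalizer.desc c.glueData.diagram _ b (fun ij => hb' ij.1 ij.2),
    fun i => Multicoequalizer.π_desc _ _ _ _ _⟩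

end Cocycle

/-- A family of charts of `Y`: open immersions `U_i × Z_n → Y` of `ℂ`-schemes extending the
restriction to `U_i` of a given morphism `C → Y`, the `U_i` forming an open cover of `C`. -/
structure ChartFamily {C Y : Scheme.{0}} (ρ : Y ⟶ SpecC) (j : C ⟶ Y) (n : ℕ) [NeZero n] where
  /-- the indices of the cover -/
  J : Type
  /-- the members of the cover -/
  U : J → C.Opens
  iSup_U : ⨆ i, U i = ⊤
  /-- the charts -/
  hom : ∀ i, prodZ.over (j ≫ ρ) n (U i) ⟶ Y
  isOpenImmersion : ∀ i, IsOpenImmersion (hom i)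
  hom_str : ∀ i, hom i ≫ ρ = Scheme.Opens.ι _ ≫ prodZ.str (j ≫ ρ) n
  zeroOn_hom : ∀ i, prodZ.zeroOn (j ≫ ρ) n (U i) ≫ hom i = Scheme.Opens.ι _ ≫ j

namespace ChartFamily

attribute [instance] ChartFamily.isOpenImmersion

variable {Y : Scheme.{0}} {ρ : Y ⟶ SpecC} {j : C ⟶ Y} (A : ChartFamily ρ j n)

lemma zeroOn_incl_hom {i : A.J} {W : C.Opens} (h : W ≤ A.U i) :
    prodZ.zeroOn (j ≫ ρ) n W ≫ prodZ.incl (j ≫ ρ) n h ≫ A.hom i = Scheme.Opens.ι _ ≫ j := by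
  rw [reassoc_of% (prodZ.zeroOn_incl (π := j ≫ ρ) (n := n) h), A.zeroOn_hom,
    Scheme.homOfLE_ι_assoc]

lemma incl_hom_str {i : A.J} {W : C.Opens} (h : W ≤ A.U i) :
    prodZ.incl (j ≫ ρ) n h ≫ A.hom i ≫ ρ = Scheme.Opens.ι _ ≫ prodZ.str (j ≫ ρ) n := by
  rw [A.hom_str, Scheme.homOfLE_ι_assoc]

lemma range_incl_hom {i : A.J} {W : C.Opens} (h : W ≤ A.U i) :
    Set.range (prodZ.incl (j ≫ ρ) n h ≫ A.hom i) = j '' W := by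
  have range_eq : Set.range (prodZ.incl (j ≫ ρ) n h ≫ A.hom i) =
      Set.range (prodZ.zeroOn (j ≫ ρ) n W ≫ prodZ.incl (j ≫ ρ) n h ≫ A.hom i) := by
    rw [Scheme.Hom.comp_base (prodZ.zeroOn _ _ _), TopCat.coe_comp, Set.range_comp,
      (prodZ.zeroOn (j ≫ ρ) n W).surjective.range_eq, Set.image_univ]
  rw [range_eq, A.zeroOn_incl_hom, Scheme.Hom.comp_base, TopCat.coe_comp, Set.range_comp,
    Scheme.Opens.range_ι, prodZ.zero_preimage_fst_preimage]

lemma range_hom (i : A.J) : Set.range (A.hom i) = j '' A.U i := by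
  rw [← A.range_incl_hom le_rfl, prodZ.incl, Scheme.homOfLE_rfl, Category.id_comp]

/-- The change of charts `hom_k⁻¹ ∘ hom_i` over `U_i ∩ U_k`: both charts have
image `j(U_i ∩ U_k)`. -/
def transition (i k : A.J) : prodZ.over (j ≫ ρ) n (A.U i ⊓ A.U k) ≅
    prodZ.over (j ≫ ρ) n (A.U i ⊓ A.U k) :=
  IsOpenImmersion.isoOfRangeEq (prodZ.incl (j ≫ ρ) n inf_le_left ≫ A.hom i)
    (prodZ.incl (j ≫ ρ) n inf_le_right ≫ A.hom k) (by rw [range_incl_hom, range_incl_hom])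

lemma transition_hom (i k : A.J) :
    (A.transition i k).hom ≫ prodZ.incl (j ≫ ρ) n inf_le_right ≫ A.hom k =
      prodZ.incl (j ≫ ρ) n inf_le_left ≫ A.hom i :=
  IsOpenImmersion.isoOfRangeEq_hom_fac _ _ _

/-- The change of charts as an element of `𝒢_n(U_i ∩ U_k)`. -/
def g (i k : A.J) : G (j ≫ ρ) n (A.U i ⊓ A.U k) where
  iso := A.transition i k
  over_base := by
    rw [← A.incl_hom_str (W := A.U i ⊓ A.U k) inf_le_right, reassoc_of% (A.transition_hom i k),
      A.incl_hom_str, A.incl_hom_str]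
  fix_zero := by
    rw [← cancel_mono (prodZ.incl (j ≫ ρ) n inf_le_right ≫ A.hom k), Category.assoc,
      A.transition_hom, A.zeroOn_incl_hom, A.zeroOn_incl_hom]

lemma g_res {i k : A.J} {W : C.Opens} (h : W ≤ A.U i ⊓ A.U k) :
    (A.g i k).res h ≫ prodZ.incl (j ≫ ρ) n (h.trans inf_le_right) ≫ A.hom k =
      prodZ.incl (j ≫ ρ) n (h.trans inf_le_left) ≫ A.hom i := by
  have h_res := (A.g i k).res_incl h =≫ (prodZ.incl (j ≫ ρ) n inf_le_right ≫ A.hom k)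
  simp only [Category.assoc] at h_res
  rw [Scheme.homOfLE_homOfLE_assoc] at h_res
  rw [h_res]
  change _ ≫ (A.transition i k).hom ≫ _ = _
  rw [A.transition_hom, Scheme.homOfLE_homOfLE_assoc]

/-- The cocycle of the changes of charts. -/
def cocycle : Cocycle (j ≫ ρ) n where
  J := A.J
  U := A.U
  iSup_U := A.iSup_U
  g := A.g
  cocycle i k l := by
    rw [← cancel_mono (prodZ.incl (j ≫ ρ) n inf_le_right ≫ A.hom l), Category.assoc,
      A.g_res (le_inf (inf_le_left.trans inf_le_left) inf_le_right),
      A.g_res (le_inf (inf_le_left.trans inf_le_right) inf_le_right), A.g_res inf_le_left]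

/-- The charts of the scheme glued from `A.cocycle`, indexed by `A.J` instead of `A.cocycle.J`. -/
def gluedChart (i : A.J) : prodZ.over (j ≫ ρ) n (A.U i) ⟶ A.cocycle.glued :=
  A.cocycle.chart i

lemma gluedChart_condition (i k : A.J) :
    prodZ.incl (j ≫ ρ) n (inf_le_left : A.U i ⊓ A.U k ≤ A.U i) ≫ A.gluedChart i =
      (A.transition i k).hom ≫ prodZ.incl (j ≫ ρ) n inf_le_right ≫ A.gluedChart k :=
  A.cocycle.chart_condition i k

lemma exists_gluedChart_comp_eq_hom :
    ∃ f : A.cocycle.glued ⟶ Y, ∀ i, A.gluedChart i ≫ f = A.hom i :=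
  A.cocycle.exists_chart_comp_eq A.hom fun i k => (A.transition_hom i k).symm

/-- The charts as an open cover of `Y`. -/
def cover (hj : Function.Surjective j) : Y.OpenCover :=
  Scheme.Cover.mkOfCovers A.J (fun i => prodZ.over (j ≫ ρ) n (A.U i)) A.hom
    (fun y => by
      obtain ⟨c, rfl⟩ := hj y
      obtain ⟨i, hi⟩ : ∃ i, c ∈ A.U i := by
        rw [← TopologicalSpace.Opens.mem_iSup, A.iSup_U]
        trivial
      exact ⟨i, (A.range_hom i).ge ⟨c, hi, rfl⟩⟩)
    A.isOpenImmersion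

lemma range_pullback_fst_subset (hj : Function.Injective j) (i k : A.J) :
    Set.range (pullback.fst (A.hom i) (A.hom k)) ⊆
      Set.range (prodZ.incl (j ≫ ρ) n (inf_le_left : A.U i ⊓ A.U k ≤ A.U i)) := by
  rintro _ ⟨p, rfl⟩
  have h_comm : A.hom i (pullback.fst (A.hom i) (A.hom k) p) =
      A.hom k (pullback.snd (A.hom i) (A.hom k) p) := by
    rw [← Scheme.Hom.comp_apply, pullback.condition, Scheme.Hom.comp_apply]
  have h_mem : A.hom i (pullback.fst (A.hom i) (A.hom k) p) ∈ j '' (A.U i ⊓ A.U k : C.Opens) := by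
    rw [TopologicalSpace.Opens.coe_inf, Set.image_inter hj, ← A.range_hom, ← A.range_hom]
    exact ⟨⟨_, rfl⟩, h_comm ▸ ⟨_, rfl⟩⟩
  rw [← A.range_incl_hom inf_le_left] at h_mem
  obtain ⟨x, hx⟩ := h_mem
  refine ⟨x, (A.hom i).injective ?_⟩
  rw [← hx, Scheme.Hom.comp_apply]

lemma pullback_fst_gluedChart (hj : Function.Injective j) (i k : A.J) :
    pullback.fst (A.hom i) (A.hom k) ≫ A.gluedChart i =
      pullback.snd (A.hom i) (A.hom k) ≫ A.gluedChart k := by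
  obtain ⟨q, hq⟩ : ∃ q, q ≫ prodZ.incl (j ≫ ρ) n inf_le_left =
      pullback.fst (A.hom i) (A.hom k) :=
    ⟨_, IsOpenImmersion.lift_fac _ _ (A.range_pullback_fst_subset hj i k)⟩
  have hq_snd : q ≫ (A.transition i k).hom ≫ prodZ.incl (j ≫ ρ) n inf_le_right =
      pullback.snd (A.hom i) (A.hom k) := by
    rw [← cancel_mono (A.hom k), Category.assoc, Category.assoc, A.transition_hom,
      reassoc_of% hq, pullback.condition]
  rw [← hq_snd, ← hq, Category.assoc, A.gluedChart_condition, Category.assoc, Category.assoc]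

theorem isAbstractPrimitiveCurve (A : ChartFamily ρ j n) (hj : Function.Bijective j) :
    IsAbstractPrimitiveCurve ρ j n := by
  obtain ⟨f, hf⟩ := A.exists_gluedChart_comp_eq_hom
  obtain ⟨f', hf'⟩ : ∃ f' : Y ⟶ A.cocycle.glued, ∀ i, A.hom i ≫ f' = A.gluedChart i :=
    ⟨(A.cover hj.2).glueMorphisms A.gluedChart (A.pullback_fst_gluedChart hj.1),
      (A.cover hj.2).ι_glueMorphisms A.gluedChart (A.pullback_fst_gluedChart hj.1)⟩
  refine ⟨A.cocycle, ⟨f, f', ?_, ?_⟩, ?_, fun (i : A.J) => ?_⟩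
  · refine A.cocycle.glued_hom_ext fun (i : A.J) => ?_
    change A.gluedChart i ≫ f ≫ f' = A.gluedChart i ≫ 𝟙 _
    rw [reassoc_of% (hf i), hf', Category.comp_id]
  · refine Scheme.Cover.hom_ext (A.cover hj.2) _ _ fun (i : A.J) => ?_
    change A.hom i ≫ f' ≫ f = A.hom i ≫ 𝟙 _
    rw [reassoc_of% (hf' i), hf, Category.comp_id]
  · refine A.cocycle.glued_hom_ext fun (i : A.J) => ?_
    change A.gluedChart i ≫ f ≫ ρ = A.cocycle.chart i ≫ A.cocycle.str
    rw [reassoc_of% (hf i), A.hom_str]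
    exact (A.cocycle.chart_str i).symm
  · change prodZ.zeroOn (j ≫ ρ) n (A.U i) ≫ A.gluedChart i ≫ f = Scheme.Opens.ι _ ≫ j
    rw [hf, A.zeroOn_hom]

end ChartFamily

end Gluing

/-! ### Charts from truncated parameters -/

section Constants

universe u

variable {R : CommRingCat.{u}} {C Y : Scheme.{u}} (ρ : Y ⟶ Spec R)

lemma le_preimage_top (V : Y.Opens) : V ≤ ρ ⁻¹ᵁ ⊤ := fun _ _ => trivial

/-- The structure homomorphism `R → Γ(Y, V)` of the `R`-algebra of sections over `V` of a scheme
`Y` over `Spec R`. -/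
noncomputable def constants (V : Y.Opens) : R ⟶ Γ(Y, V) :=
  (Scheme.ΓSpecIso R).inv ≫ ρ.appLE ⊤ V (le_preimage_top ρ V)

lemma constants_app (j : C ⟶ Y) (V : Y.Opens) :
    constants ρ V ≫ j.app V = constants (j ≫ ρ) (j ⁻¹ᵁ V) := by
  rw [constants, constants, Category.assoc, Scheme.Hom.app_eq_appLE,
    Scheme.Hom.appLE_comp_appLE]

lemma toSpecΓ_constants (V : Y.Opens) : V.toSpecΓ ≫ Spec.map (constants ρ V) = V.ι ≫ ρ := by
  rw [constants, Spec.map_comp, Scheme.Opens.toSpecΓ_SpecMap_appLE_assoc,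
    Scheme.Opens.toSpecΓ_top, Category.assoc, toSpecΓ_SpecMap_ΓSpecIso_inv, Category.comp_id,
    Scheme.Hom.resLE_comp_ι]

lemma smooth_constants [Smooth ρ] {V : Y.Opens} (hV : IsAffineOpen V) :
    (constants ρ V).hom.Smooth := by
  rw [constants, CommRingCat.hom_comp]
  exact RingHom.Smooth.stableUnderComposition _ _
    (.of_bijective (ConcreteCategory.bijective_of_isIso (Scheme.ΓSpecIso R).inv))
    (Scheme.Hom.smooth_appLE ρ (isAffineOpen_top _) hV (le_preimage_top ρ V))

lemma toSpecΓ_SpecMap_app (j : C ⟶ Y) (V : Y.Opens) :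
    (j ⁻¹ᵁ V).toSpecΓ ≫ Spec.map (j.app V) = (j ∣_ V) ≫ V.toSpecΓ := by
  rw [Scheme.Hom.app_eq_appLE, Scheme.Opens.toSpecΓ_SpecMap_appLE,
    Scheme.Hom.resLE_eq_morphismRestrict]

end Constants

lemma constants_germ {Y : Scheme.{0}} (ρ : Y ⟶ SpecC) (V : Y.Opens) (y : Y) (hy : y ∈ V) :
    constants ρ V ≫ Y.presheaf.germ V y hy =
      CommRingCat.ofHom (algebraMap ℂ (LocalRingAt ρ y)) := by
  change _ = (Scheme.ΓSpecIso (.of ℂ)).inv ≫ ρ.appTop ≫ Y.presheaf.germ ⊤ y _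
  rw [constants, Category.assoc, Scheme.Hom.appLE, Category.assoc, Y.presheaf.germ_res]
  rfl

lemma TruncPoly.ringHom_ext {A : Type*} [Semiring A] {n : ℕ} {g h : TruncPoly n →+* A}
    (h_const : ∀ z, g (algebraMap ℂ (TruncPoly n) z) = h (algebraMap ℂ (TruncPoly n) z))
    (h_t : g (TruncPoly.t n) = h (TruncPoly.t n)) : g = h :=
  Ideal.Quotient.ringHom_ext (Polynomial.ringHom_ext h_const h_t)

lemma TruncPoly.evalZero_algebraMap (n : ℕ) [NeZero n] (z : ℂ) :
    TruncPoly.evalZero n (algebraMap ℂ (TruncPoly n) z) = z :=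
  (Polynomial.eval_C (R := ℂ) (a := z) (x := 0) :)

lemma TruncPoly.evalZero_t (n : ℕ) [NeZero n] : TruncPoly.evalZero n (TruncPoly.t n) = 0 :=
  (Polynomial.eval_X (R := ℂ) (x := 0) :)

namespace IsTruncatedParameter

lemma exists_algHom_section {R A B : Type*} [CommRing R] [CommRing A] [CommRing B] [Algebra R A]
    [Algebra R B] [Algebra.FormallySmooth R A] {r : B →ₐ[R] A} (hr : Function.Surjective r) {f : B}
    {n : ℕ} (hf : IsTruncatedParameter (r : B →+* A) f n) :
    ∃ σ : A →ₐ[R] B, ∀ a, r (σ a) = a :=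
  ⟨Algebra.FormallySmooth.liftOfSurjective (.id R A) r hr hf.isNilpotent_ker,
    Algebra.FormallySmooth.liftOfSurjective_apply (.id R A) r hr hf.isNilpotent_ker⟩

theorem exists_isPushout {A B : CommRingCat.{0}} {a : .of ℂ ⟶ A} {b : .of ℂ ⟶ B} {r : B ⟶ A}
    (hbr : b ≫ r = a) (ha : a.hom.FormallySmooth) (hr : Function.Surjective r) {f : B} {n : ℕ}
    [NeZero n] (hf : IsTruncatedParameter r.hom f n) :
    ∃ (p : A ⟶ B) (q : .of (TruncPoly n) ⟶ B),
      IsPushout a (CommRingCat.ofHom (algebraMap ℂ (TruncPoly n))) p q ∧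
      p ≫ r = 𝟙 A ∧ q ≫ r = CommRingCat.ofHom (TruncPoly.evalZero n) ≫ a ∧
      CommRingCat.ofHom (algebraMap ℂ (TruncPoly n)) ≫ q = b := by
  algebraize [a.hom, b.hom]
  let rₐ : B →ₐ[ℂ] A := { r.hom with commutes' := fun z => congr($hbr z) }
  obtain ⟨σ, hσ⟩ := exists_algHom_section (r := rₐ) hr hf
  obtain ⟨e, he_left, he_right⟩ := exists_tensorProduct_algEquiv (r := rₐ) hf hσ
  refine ⟨CommRingCat.ofHom (e.toAlgHom.comp Algebra.TensorProduct.includeLeft).toRingHom,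
    CommRingCat.ofHom (e.toAlgHom.comp Algebra.TensorProduct.includeRight).toRingHom,
    ?_, ?_, ?_, ?_⟩
  · refine (CommRingCat.isPushout_tensorProduct ℂ A (TruncPoly n)).of_iso (Iso.refl _) (Iso.refl _)
      (Iso.refl _) e.toRingEquiv.toCommRingCatIso ?_ ?_ ?_ ?_
    all_goals rfl
  · ext x
    exact (congrArg rₐ (he_left x)).trans (hσ x)
  · refine CommRingCat.hom_ext (TruncPoly.ringHom_ext (fun z => ?_) ?_)
    · change rₐ (e (1 ⊗ₜ algebraMap ℂ (TruncPoly n) z)) =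
        a (TruncPoly.evalZero n (algebraMap ℂ (TruncPoly n) z))
      rw [TruncPoly.evalZero_algebraMap]
      exact (congrArg rₐ ((e.toAlgHom.comp Algebra.TensorProduct.includeRight).commutes z)).trans
        (rₐ.commutes z)
    · change rₐ (e (1 ⊗ₜ TruncPoly.t n)) = a (TruncPoly.evalZero n (TruncPoly.t n))
      rw [TruncPoly.t, he_right, ← TruncPoly.t, TruncPoly.evalZero_t, map_zero]
      exact hf.map_self
  · ext z
    exact (e.toAlgHom.comp Algebra.TensorProduct.includeRight).commutes z

end IsTruncatedParameter

/-- The open subscheme `V` of `Y` is isomorphic to `U × Z_n`, where `U = j⁻¹(V)` for a morphism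
`j : C → Y` of `ℂ`-schemes: there is an isomorphism `V ≅ U × Z_n` of `ℂ`-schemes whose composite
with `U → V` is the inclusion `U → U × Z_n`. -/
def IsProductOver {C Y : Scheme.{0}} (ρ : Y ⟶ SpecC) (j : C ⟶ Y) (n : ℕ) [NeZero n]
    (V : Y.Opens) : Prop :=
  ∃ e : V.toScheme ≅ prodZ ((j ⁻¹ᵁ V).ι ≫ j ≫ ρ) n,
    e.hom ≫ prodZ.str _ n = V.ι ≫ ρ ∧ (j ∣_ V) ≫ e.hom = prodZ.zero _ n

section Chart

variable {C Y : Scheme.{0}} (ρ : Y ⟶ SpecC) (j : C ⟶ Y) {n : ℕ} {V : Y.Opens}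

lemma isPullback_toSpecΓ_of_isPushout (hV : IsAffineOpen V) (hC : IsAffineOpen (j ⁻¹ᵁ V))
    {p : Γ(C, j ⁻¹ᵁ V) ⟶ Γ(Y, V)} {q : .of (TruncPoly n) ⟶ Γ(Y, V)}
    (h : IsPushout (constants (j ≫ ρ) (j ⁻¹ᵁ V))
      (CommRingCat.ofHom (algebraMap ℂ (TruncPoly n))) p q) :
    IsPullback (V.toSpecΓ ≫ Spec.map p ≫ hC.isoSpec.inv) (V.toSpecΓ ≫ Spec.map q)
      ((j ⁻¹ᵁ V).ι ≫ j ≫ ρ) (Z.str n) := by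
  refine (isPullback_SpecMap_of_isPushout _ _ _ _ h).of_iso hV.isoSpec.symm hC.isoSpec.symm
    (Iso.refl _) (Iso.refl _) ?_ ?_ ?_ ?_
  · simp
  · simp
  · rw [← toSpecΓ_constants (j ≫ ρ)]
    simp
  · simp [Z.str]

theorem isProductOver_of_isPushout [NeZero n] (hV : IsAffineOpen V) (hC : IsAffineOpen (j ⁻¹ᵁ V))
    {p : Γ(C, j ⁻¹ᵁ V) ⟶ Γ(Y, V)} {q : .of (TruncPoly n) ⟶ Γ(Y, V)}
    (h : IsPushout (constants (j ≫ ρ) (j ⁻¹ᵁ V))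
      (CommRingCat.ofHom (algebraMap ℂ (TruncPoly n))) p q) (hp : p ≫ j.app V = 𝟙 _)
    (hq : q ≫ j.app V =
      CommRingCat.ofHom (TruncPoly.evalZero n) ≫ constants (j ≫ ρ) (j ⁻¹ᵁ V))
    (hq_const : CommRingCat.ofHom (algebraMap ℂ (TruncPoly n)) ≫ q = constants ρ V) :
    IsProductOver ρ j n V := by
  have h_pb := isPullback_toSpecΓ_of_isPushout ρ j hV hC h
  refine ⟨h_pb.isoPullback, ?_, pullback.hom_ext ?_ ?_⟩
  · rw [prodZ.str, prodZ.fst, IsPullback.isoPullback_hom_fst_assoc, h_pb.w, Z.str, Category.assoc,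
      ← Spec.map_comp, hq_const, toSpecΓ_constants]
  · rw [Category.assoc, IsPullback.isoPullback_hom_fst, ← reassoc_of% (toSpecΓ_SpecMap_app j V),
      ← Spec.map_comp_assoc, hp, Spec.map_id, prodZ.zero_fst, Category.id_comp]
    exact hC.toSpecΓ_isoSpec_inv
  · rw [Category.assoc, IsPullback.isoPullback_hom_snd,
      ← reassoc_of% (toSpecΓ_SpecMap_app j V), ← Spec.map_comp, hq, prodZ.zero,
      pullback.lift_snd, ← toSpecΓ_constants, Z.zero, Category.assoc, ← Spec.map_comp]

theorem isProductOver_of_isTruncatedParameter [NeZero n] (hV : IsAffineOpen V)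
    (hC : IsAffineOpen (j ⁻¹ᵁ V)) [Smooth (j ≫ ρ)] (hj : Function.Surjective (j.app V))
    {f : Γ(Y, V)} (hf : IsTruncatedParameter (j.app V).hom f n) : IsProductOver ρ j n V := by
  obtain ⟨p, q, h, hp, hq, hq_const⟩ := hf.exists_isPushout (constants_app ρ j V)
    (smooth_constants (j ≫ ρ) hC).1 hj
  exact isProductOver_of_isPushout ρ j hV hC h hp hq hq_const

end Chart

/-! ### Truncated parameters of stalks and of rings of sections -/

section Stalk

universe u

variable {C Y : Scheme.{u}} (j : C ⟶ Y) [IsClosedImmersion j] {V : Y.Opens} (hV : IsAffineOpen V)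
  (c : C) (hc : j c ∈ V)

include hV in
lemma isLocalization_map_primeCompl_stalk :
    letI := C.presheaf.algebra_section_stalk (U := j ⁻¹ᵁ V) ⟨c, hc⟩
    IsLocalization ((hV.primeIdealOf ⟨j c, hc⟩).asIdeal.primeCompl.map (j.app V).hom)
      (C.presheaf.stalk c) := by
  let := C.presheaf.algebra_section_stalk (U := j ⁻¹ᵁ V) ⟨c, hc⟩
  have hC : IsAffineOpen (j ⁻¹ᵁ V) := hV.preimage j
  have h_comap := IsAffineOpen.comap_primeIdealOf_appLE (f := j) V hV (j ⁻¹ᵁ V) hC le_rfl hc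
  rw [← Scheme.Hom.app_eq_appLE] at h_comap
  have h_map : (hV.primeIdealOf ⟨j c, hc⟩).asIdeal.primeCompl.map (j.app V).hom =
      (hC.primeIdealOf ⟨c, hc⟩).asIdeal.primeCompl := by
    rw [← h_comap]
    exact Submonoid.map_comap_eq_of_surjective (f := (j.app V).hom) (j.app_surjective V hV)
      (hC.primeIdealOf ⟨c, hc⟩).asIdeal.primeCompl
  rw [h_map]
  exact hC.isLocalization_stalk ⟨c, hc⟩

variable {n : ℕ}

include hV in
lemma IsTruncatedParameter.germ {f : Γ(Y, V)} (hf : IsTruncatedParameter (j.app V).hom f n) :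
    IsTruncatedParameter (j.stalkMap c).hom (Y.presheaf.germ V (j c) hc f) n := by
  let := Y.presheaf.algebra_section_stalk ⟨j c, hc⟩
  let := C.presheaf.algebra_section_stalk (U := j ⁻¹ᵁ V) ⟨c, hc⟩
  have := hV.isLocalization_stalk ⟨j c, hc⟩
  have := isLocalization_map_primeCompl_stalk j hV c hc
  exact (isTruncatedParameter_algebraMap_iff (hV.primeIdealOf ⟨j c, hc⟩).asIdeal.primeCompl
    (Scheme.Hom.germ_stalkMap_apply j V c hc)).mpr (hf.awayFrom _)

lemma isTruncatedParameter_app_basicOpen_iff {f g : Γ(Y, V)} (hV : IsAffineOpen V) :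
    IsTruncatedParameter (j.app (Y.basicOpen g)).hom
        (Y.presheaf.map (homOfLE (Y.basicOpen_le g)).op f) n ↔
      IsTruncatedParameterAwayFrom (Submonoid.powers g) (j.app V).hom f n := by
  have := hV.isLocalization_basicOpen g
  let := (C.presheaf.map (homOfLE (j.preimage_mono (Y.basicOpen_le g))).op).hom.toAlgebra
  have : IsLocalization ((Submonoid.powers g).map (j.app V).hom)
      Γ(C, j ⁻¹ᵁ Y.basicOpen g) := by
    rw [Submonoid.map_powers]
    exact (hV.preimage j).isLocalization_of_eq_basicOpen (j.app V g) _
      (Scheme.preimage_basicOpen j g)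
  exact isTruncatedParameter_algebraMap_iff (Submonoid.powers g) fun x =>
    congr($(j.naturality (homOfLE (Y.basicOpen_le g)).op) x)

include hV hc in
lemma exists_isTruncatedParameter_basicOpen [IsNoetherianRing Γ(Y, V)]
    {f' : Y.presheaf.stalk (j c)} (hf' : IsTruncatedParameter (j.stalkMap c).hom f' n) :
    ∃ g : Γ(Y, V), j c ∈ Y.basicOpen g ∧
      ∃ f, IsTruncatedParameter (j.app (Y.basicOpen g)).hom f n := by
  let := Y.presheaf.algebra_section_stalk ⟨j c, hc⟩
  let := C.presheaf.algebra_section_stalk (U := j ⁻¹ᵁ V) ⟨c, hc⟩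
  have := hV.isLocalization_stalk ⟨j c, hc⟩
  have := isLocalization_map_primeCompl_stalk j hV c hc
  obtain ⟨f, hf⟩ := exists_isTruncatedParameterAwayFrom
    (hV.primeIdealOf ⟨j c, hc⟩).asIdeal.primeCompl (φ := (j.app V).hom)
    (Scheme.Hom.germ_stalkMap_apply j V c hc) hf'
  obtain ⟨g, hg, hfg⟩ := hf.exists_powers
  refine ⟨g, ?_, _, (isTruncatedParameter_app_basicOpen_iff j hV).mpr hfg⟩
  rw [Scheme.mem_basicOpen _ _ _ hc]
  exact IsLocalization.map_units (Y.presheaf.stalk (j c))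
    (⟨g, hg⟩ : (hV.primeIdealOf ⟨j c, hc⟩).asIdeal.primeCompl)

omit [IsClosedImmersion j] in
lemma isNilpotent_of_app_eq_zero (hj : Function.Surjective j) (hV : IsAffineOpen V) {s : Γ(Y, V)}
    (hs : j.app V s = 0) : IsNilpotent s := by
  rw [Scheme.isNilpotent_iff_basicOpen_eq_bot_of_isCompact hV.isCompact, eq_bot_iff]
  refine fun y hy => ?_
  obtain ⟨c, rfl⟩ := hj y
  change c ∈ j ⁻¹ᵁ Y.basicOpen s at hy
  rwa [Scheme.preimage_basicOpen, hs, Scheme.basicOpen_zero] at hy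

lemma isNilpotent_of_stalkMap_eq_zero (hj : Function.Surjective j) (c : C)
    {a : Y.presheaf.stalk (j c)} (ha : j.stalkMap c a = 0) : IsNilpotent a := by
  obtain ⟨_, ⟨V, hV, rfl⟩, hc, -⟩ := Y.isBasis_affineOpens.exists_subset_of_mem_open
    (Set.mem_univ (j c)) isOpen_univ
  let := Y.presheaf.algebra_section_stalk ⟨j c, hc⟩
  let := C.presheaf.algebra_section_stalk (U := j ⁻¹ᵁ V) ⟨c, hc⟩
  have := hV.isLocalization_stalk ⟨j c, hc⟩
  have := isLocalization_map_primeCompl_stalk j hV c hc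
  exact isNilpotent_of_map_eq_zero_of_isLocalization
    (hV.primeIdealOf ⟨j c, hc⟩).asIdeal.primeCompl (φ := (j.app V).hom)
    (φ' := (j.stalkMap c).hom) (Scheme.Hom.germ_stalkMap_apply j V c hc)
    (fun _ => isNilpotent_of_app_eq_zero j hj hV) ha

end Stalk

/-! ### Infinitesimal neighbourhoods of smooth hypersurfaces -/

section IdealSheaf

universe u

variable {X : Scheme.{u}} {I J : X.IdealSheafData}

lemma subschemeι_app_eq_zero_iff (U : X.affineOpens) (x : Γ(X, U.1)) :
    I.subschemeι.app U.1 x = 0 ↔ x ∈ I.ideal U := by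
  rw [← I.ker_subschemeι_app U]
  rfl

lemma ker_inclusion_app_comp_subschemeι_app (h : I ≤ J) (U : X.affineOpens) :
    RingHom.ker (((Scheme.IdealSheafData.inclusion h).app (I.subschemeι ⁻¹ᵁ U.1)).hom.comp
      (I.subschemeι.app U.1).hom) = J.ideal U := by
  have h_ker (g : J.subscheme ⟶ X) (hg : g = J.subschemeι) :
      RingHom.ker (g.app U.1).hom = J.ideal U := by
    rw [hg, J.ker_subschemeι_app]
  rw [← CommRingCat.hom_comp, ← Scheme.Hom.comp_app]
  exact h_ker _ (Scheme.IdealSheafData.inclusion_subschemeι h)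

lemma mem_subschemeι_preimage_of_mem (h : I ≤ J) {U : X.Opens} {y : J.subscheme}
    (hy : J.subschemeι y ∈ U) : Scheme.IdealSheafData.inclusion h y ∈ I.subschemeι ⁻¹ᵁ U := by
  rwa [← Scheme.IdealSheafData.inclusion_subschemeι h] at hy

end IdealSheaf

lemma formallySmooth_localRingAt {Y : Scheme.{0}} (ρ : Y ⟶ SpecC) [Smooth ρ] (y : Y) :
    Algebra.FormallySmooth ℂ (LocalRingAt ρ y) := by
  obtain ⟨_, ⟨V, hV, rfl⟩, hy, -⟩ := Y.isBasis_affineOpens.exists_subset_of_mem_open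
    (Set.mem_univ y) isOpen_univ
  let := Y.presheaf.algebra_section_stalk ⟨y, hy⟩
  have := hV.isLocalization_stalk ⟨y, hy⟩
  have h_germ : (Y.presheaf.germ V y hy).hom.FormallySmooth :=
    RingHom.formallySmooth_algebraMap.mpr <|
      Algebra.FormallySmooth.of_isLocalization (hV.primeIdealOf ⟨y, hy⟩).asIdeal.primeCompl
  rw [← RingHom.formallySmooth_algebraMap,
    ← show _ = algebraMap ℂ (LocalRingAt ρ y) from
      congrArg CommRingCat.Hom.hom (constants_germ ρ V y hy)]
  exact (smooth_constants ρ hV).formallySmooth.comp h_germ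

namespace IsSmoothHypersurface

variable {X : Scheme.{0}} {π : X ⟶ SpecC} {I : X.IdealSheafData} (n : ℕ) [NeZero n]

lemma exists_isTruncatedParameter (hI : IsSmoothHypersurface π I) (x : X) :
    ∃ U : X.affineOpens, x ∈ U.1 ∧
      ∃ f, IsTruncatedParameter ((thickIncl I n).app ((I ^ n).subschemeι ⁻¹ᵁ U.1)).hom f n := by
  obtain ⟨U, f, hx, hf, hfI⟩ := hI.local_equation x
  refine ⟨U, hx, (I ^ n).subschemeι.app U.1 f, .of_ker_eq_span_pow
    ((I ^ n).subschemeι_app_surjective U) hf ?_ ?_⟩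
  · rw [Scheme.IdealSheafData.ker_subschemeι_app, Scheme.IdealSheafData.ideal_pow, Pi.pow_apply,
      hfI, Ideal.span_singleton_pow]
  · rw [← hfI]
    exact ker_inclusion_app_comp_subschemeι_app (pow_le I n) U

lemma exists_isTruncatedParameter_restriction (hI : IsSmoothHypersurface π I)
    (P : I.subscheme) :
    ∃ f, IsTruncatedParameter (restriction π I n P :
      LocalRingAt (subStr π (I ^ n)) (thickIncl I n P) →+* LocalRingAt (subStr π I) P) f n := by
  obtain ⟨U, hPU, f, hf⟩ := hI.exists_isTruncatedParameter n (I.subschemeι P)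
  exact ⟨_, hf.germ (thickIncl I n) (U.2.preimage _) P
    (mem_subschemeι_preimage_of_mem (pow_le I n) hPU)⟩

theorem exists_section_restriction (hI : IsSmoothHypersurface π I) (P : I.subscheme) :
    ∃ σ : LocalRingAt (subStr π I) P →ₐ[ℂ] LocalRingAt (subStr π (I ^ n)) (thickIncl I n P),
      ∀ a, restriction π I n P (σ a) = a := by
  have := hI.smooth
  have := formallySmooth_localRingAt (subStr π I) P
  obtain ⟨f, hf⟩ := hI.exists_isTruncatedParameter_restriction n P
  exact IsTruncatedParameter.exists_algHom_section ((thickIncl I n).stalkMap_surjective P) hf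

theorem exists_algEquiv_of_section (hI : IsSmoothHypersurface π I) {P : I.subscheme}
    {σ : LocalRingAt (subStr π I) P →ₐ[ℂ] LocalRingAt (subStr π (I ^ n)) (thickIncl I n P)}
    (hσ : ∀ a, restriction π I n P (σ a) = a) :
    ∃ e : (LocalRingAt (subStr π I) P ⊗[ℂ] TruncPoly n) ≃ₐ[ℂ]
        LocalRingAt (subStr π (I ^ n)) (thickIncl I n P),
      (∀ a, e (a ⊗ₜ 1) = σ a) ∧ restriction π I n P (e (1 ⊗ₜ TruncPoly.t n)) = 0 := by
  obtain ⟨f, hf⟩ := hI.exists_isTruncatedParameter_restriction n P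
  obtain ⟨e, he_left, he_t⟩ := IsTruncatedParameter.exists_tensorProduct_algEquiv hf hσ
  exact ⟨e, he_left, (congrArg (restriction π I n P) he_t).trans hf.map_self⟩

theorem exists_isProductOver (hI : IsSmoothHypersurface π I) (P : I.subscheme) :
    ∃ V, thickIncl I n P ∈ V ∧ IsProductOver (subStr π (I ^ n)) (thickIncl I n) n V := by
  obtain ⟨U, hPU, f, hf⟩ := hI.exists_isTruncatedParameter n (I.subschemeι P)
  have h_affine : IsAffineOpen ((I ^ n).subschemeι ⁻¹ᵁ U.1) := U.2.preimage _
  have : Smooth (thickIncl I n ≫ subStr π (I ^ n)) := by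
    simpa using hI.smooth
  exact ⟨_, mem_subschemeι_preimage_of_mem (pow_le I n) hPU,
    isProductOver_of_isTruncatedParameter _ _ h_affine (h_affine.preimage _)
      ((thickIncl I n).app_surjective _ h_affine) hf⟩

end IsSmoothHypersurface

/-! ### Closed points of smooth schemes and of their closed subschemes -/

section ClosedPoint

universe u

variable {K : Type u} [Field K] [IsAlgClosed K] {d : ℕ}

theorem exists_maximalIdeal_stalk_eq_span {Y : Scheme.{u}} {ρ : Y ⟶ Spec (.of K)}
    (hρ : SmoothOfRelativeDimension d ρ) {y : Y} (hy : IsClosed {y}) :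
    ∃ x : Fin d → Y.presheaf.stalk y,
      IsLocalRing.maximalIdeal (Y.presheaf.stalk y) = Ideal.span (Set.range x) ∧
        ∀ i, IsSMulRegular (Y.presheaf.stalk y) (x i) := by
  obtain ⟨U, hU, V, hV, hyV, hVU, h⟩ := hρ.exists_isStandardSmoothOfRelativeDimension y
  obtain rfl : U = ⊤ := by
    refine top_le_iff.mp fun z _ => ?_
    rw [← Subsingleton.elim (α := PrimeSpectrum K) (ρ y) z]
    exact hVU hyV
  have h_const : (constants ρ V).hom.IsStandardSmoothOfRelativeDimension d :=
    (RingHom.isStandardSmoothOfRelativeDimension_respectsIso (n := d)).2 (ρ.appLE ⊤ V hVU).hom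
      (Scheme.ΓSpecIso (.of K)).symm.commRingCatIsoToRingEquiv h
  let := Y.presheaf.algebra_section_stalk ⟨y, hyV⟩
  have := hV.isLocalization_stalk ⟨y, hyV⟩
  have := hV.primeIdealOf_isMaximal_of_isClosed ⟨y, hyV⟩ hy
  exact exists_maximalIdeal_eq_span_of_isStandardSmooth h_const
    (hV.primeIdealOf ⟨y, hyV⟩).asIdeal

lemma exists_isClosedImmersion_of_ideal_le {X : Scheme.{u}} {I J : X.IdealSheafData} {W : X.Opens}
    (hJI : ∀ V : X.affineOpens, V.1 ≤ W → J.ideal V ≤ I.ideal V) :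
    ∃ i : (I.subschemeι ⁻¹ᵁ W).toScheme ⟶ (J.subschemeι ⁻¹ᵁ W).toScheme, IsClosedImmersion i := by
  have h_ker : (J.subschemeι ∣_ W).ker ≤ (I.subschemeι ∣_ W).ker := fun V => by
    rw [Scheme.ker_morphismRestrict_ideal, Scheme.ker_morphismRestrict_ideal,
      Scheme.IdealSheafData.ker_subschemeι, Scheme.IdealSheafData.ker_subschemeι]
    exact hJI _ (W.ι_image_le V.1)
  let i := IsClosedImmersion.lift (J.subschemeι ∣_ W) (I.subschemeι ∣_ W) h_ker
  have : IsClosedImmersion (i ≫ J.subschemeι ∣_ W) := by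
    rw [IsClosedImmersion.lift_fac]
    infer_instance
  exact ⟨i, .of_comp i (J.subschemeι ∣_ W)⟩

theorem exists_maximalIdeal_stalk_subscheme_eq_span {X : Scheme.{u}} {π : X ⟶ Spec (.of K)}
    {I J : X.IdealSheafData} {W : X.Opens}
    (hJ : SmoothOfRelativeDimension d ((J.subschemeι ⁻¹ᵁ W).ι ≫ J.subschemeι ≫ π))
    (hJI : ∀ V : X.affineOpens, V.1 ≤ W → J.ideal V ≤ I.ideal V) {y : I.subscheme}
    (hyW : I.subschemeι y ∈ W) (hy : IsClosed {y}) :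
    ∃ x : Fin d → I.subscheme.presheaf.stalk y,
      IsLocalRing.maximalIdeal (I.subscheme.presheaf.stalk y) = Ideal.span (Set.range x) := by
  obtain ⟨i, hi⟩ := exists_isClosedImmersion_of_ideal_le hJI
  obtain ⟨z, rfl⟩ : ∃ z : (I.subschemeι ⁻¹ᵁ W).toScheme, (I.subschemeι ⁻¹ᵁ W).ι z = y :=
    ⟨⟨y, hyW⟩, rfl⟩
  have hz : IsClosed {z} := preimage_closedPoints_subset
    (I.subschemeι ⁻¹ᵁ W).ι.isOpenEmbedding.injective (I.subschemeι ⁻¹ᵁ W).ι.continuous hy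
  have hiz : IsClosed {i z} := by
    rw [← Set.image_singleton]
    exact i.isClosedEmbedding.isClosedMap _ hz
  obtain ⟨x, hx, -⟩ := exists_maximalIdeal_stalk_eq_span hJ hiz
  let φ := (i.stalkMap z ≫ inv ((I.subschemeι ⁻¹ᵁ W).ι.stalkMap z)).hom
  have hφ : Function.Surjective φ :=
    (ConcreteCategory.bijective_of_isIso (inv ((I.subschemeι ⁻¹ᵁ W).ι.stalkMap z))).2.comp
      (i.stalkMap_surjective z)
  refine ⟨φ ∘ x, ?_⟩
  rw [← IsLocalRing.map_maximalIdeal_of_surjective φ hφ, hx, Ideal.map_span, Set.range_comp]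

end ClosedPoint

/-! ### Gluing products -/

section Product

variable {C Y : Scheme.{0}} {n : ℕ}

lemma prodZ.isPullback_over (π : C ⟶ SpecC) (U : C.Opens) :
    IsPullback (prodZ.fst π n ∣_ U) (Scheme.Opens.ι _ ≫ pullback.snd π (Z.str n)) (U.ι ≫ π)
      (Z.str n) :=
  ((isPullback_morphismRestrict (prodZ.fst π n) U).flip.paste_horiz
    (IsPullback.of_hasPullback π (Z.str n)).flip).flip

variable [NeZero n]

lemma prodZ.zero_snd (π : C ⟶ SpecC) :
    prodZ.zero π n ≫ pullback.snd π (Z.str n) = π ≫ Z.zero n := pullback.lift_snd _ _ _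

lemma prodZ.zeroOn_isoPullback (π : C ⟶ SpecC) (U : C.Opens) :
    prodZ.zeroOn π n U ≫ (prodZ.isPullback_over π U).isoPullback.hom =
      C.homOfLE (prodZ.zero_preimage_fst_preimage U).le ≫ prodZ.zero (U.ι ≫ π) n := by
  apply pullback.hom_ext
  · rw [Category.assoc, IsPullback.isoPullback_hom_fst, Category.assoc, prodZ.zero_fst,
      Category.comp_id, ← cancel_mono U.ι, Category.assoc, morphismRestrict_ι,
      morphismRestrict_ι_assoc, prodZ.zero_fst, Category.comp_id, Scheme.homOfLE_ι]
  · rw [Category.assoc, IsPullback.isoPullback_hom_snd, morphismRestrict_ι_assoc,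
      prodZ.zero_snd, Category.assoc, prodZ.zero_snd, Category.assoc, Scheme.homOfLE_ι_assoc]

theorem isAbstractPrimitiveCurve_of_forall_isProductOver {ρ : Y ⟶ SpecC} {j : C ⟶ Y}
    (hj : Function.Bijective j) (h : ∀ c, ∃ V, j c ∈ V ∧ IsProductOver ρ j n V) :
    IsAbstractPrimitiveCurve ρ j n := by
  choose V hV e he_str he_zero using h
  let A : ChartFamily ρ j n :=
    { J := C
      U := fun c => j ⁻¹ᵁ V c
      iSup_U := top_le_iff.mp fun c _ => TopologicalSpace.Opens.mem_iSup.mpr ⟨c, hV c⟩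
      hom := fun c =>
        (prodZ.isPullback_over (j ≫ ρ) (j ⁻¹ᵁ V c)).isoPullback.hom ≫ (e c).inv ≫ (V c).ι
      isOpenImmersion := fun c => inferInstance
      hom_str := fun c => by
        rw [Category.assoc, Category.assoc, ← he_str c, Iso.inv_hom_id_assoc,
          IsPullback.isoPullback_hom_fst_assoc, morphismRestrict_ι_assoc]
      zeroOn_hom := fun c => by
        rw [← Category.assoc, prodZ.zeroOn_isoPullback, Category.assoc, ← he_zero c,
          Category.assoc, Iso.hom_inv_id_assoc, morphismRestrict_ι, Scheme.homOfLE_ι_assoc] }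
  exact A.isAbstractPrimitiveCurve hj

end Product

/-! ### Primitive multiple curves -/

section Reduced

variable {X : Scheme.{0}} {π : X ⟶ SpecC} {I : X.IdealSheafData}

/-- The closed immersion `C = Y_red → Y`, where `Y` is the closed subscheme defined by `I`. -/
noncomputable abbrev redIncl (I : X.IdealSheafData) : I.radical.subscheme ⟶ I.subscheme :=
  Scheme.IdealSheafData.inclusion I.le_radical

lemma subschemeι_redIncl (c : I.radical.subscheme) :
    I.subschemeι (redIncl I c) = I.radical.subschemeι c := by
  rw [← Scheme.Hom.comp_apply, Scheme.IdealSheafData.inclusion_subschemeι]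

lemma subschemeι_mem_support (y : I.subscheme) : I.subschemeι y ∈ I.support := by
  have h_range : I.subschemeι y ∈ Set.range I.subschemeι := ⟨y, rfl⟩
  rwa [I.range_subschemeι] at h_range

lemma redIncl_bijective : Function.Bijective (redIncl I) := by
  refine ⟨(redIncl I).isClosedEmbedding.injective, fun y => ?_⟩
  obtain ⟨c, hc⟩ : I.subschemeι y ∈ Set.range I.radical.subschemeι := by
    rw [I.radical.range_subschemeι, Scheme.IdealSheafData.support_radical]
    exact subschemeι_mem_support y
  exact ⟨c, I.subschemeι.isClosedEmbedding.injective ((subschemeι_redIncl c).trans hc)⟩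

/-- On the affine open subset `U` of `X`, the reduced subscheme `C` of `Y` (the closed subscheme
defined by `I`) is given by one equation, which is a truncated parameter of order `n`. For
primitive multiple curves this is the local form of being of multiplicity `n`. -/
def HasParameter (I : X.IdealSheafData) (U : X.affineOpens) (n : ℕ) : Prop :=
  ∃ f, IsTruncatedParameter ((redIncl I).app (I.subschemeι ⁻¹ᵁ U.1)).hom f n

namespace HasParameter

variable {U V : X.affineOpens} {m n : ℕ} {c : I.radical.subscheme}

lemma exists_stalk (hU : HasParameter I U n) (hcU : I.radical.subschemeι c ∈ U.1) :
    ∃ f, IsTruncatedParameter ((redIncl I).stalkMap c).hom f n := by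
  obtain ⟨f, hf⟩ := hU
  exact ⟨_, hf.germ (redIncl I) (U.2.preimage _) c (mem_subschemeι_preimage_of_mem _ hcU)⟩

lemma le [NeZero m] (hU : HasParameter I U n) (hV : HasParameter I V m)
    (hcU : I.radical.subschemeι c ∈ U.1) (hcV : I.radical.subschemeι c ∈ V.1) : n ≤ m := by
  obtain ⟨f, hf⟩ := hU.exists_stalk hcU
  obtain ⟨g, hg⟩ := hV.exists_stalk hcV
  obtain ⟨z, rfl⟩ := (hg.map_eq_zero_iff f).mp hf.map_self
  exact hf.le_of_pow_eq_zero (by rw [mul_pow, hg.pow_eq_zero, zero_mul])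

lemma eq [NeZero m] [NeZero n] (hU : HasParameter I U n) (hV : HasParameter I V m)
    (hcU : I.radical.subschemeι c ∈ U.1) (hcV : I.radical.subschemeι c ∈ V.1) : n = m :=
  (hU.le hV hcU hcV).antisymm (hV.le hU hcV hcU)

lemma isProductOver [NeZero n] (hU : HasParameter I U n) [Smooth (subStr π I.radical)] :
    IsProductOver (subStr π I) (redIncl I) n (I.subschemeι ⁻¹ᵁ U.1) := by
  obtain ⟨f, hf⟩ := hU
  have h_affine : IsAffineOpen (I.subschemeι ⁻¹ᵁ U.1) := U.2.preimage _
  have : Smooth (redIncl I ≫ subStr π I) := by simpa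
  exact isProductOver_of_isTruncatedParameter _ _ h_affine (h_affine.preimage _)
    ((redIncl I).app_surjective _ h_affine) hf

lemma le_of_radical_pow_le (hU : HasParameter I U n) (hcU : I.radical.subschemeι c ∈ U.1)
    {k : ℕ} (hk : I.radical ^ k ≤ I) : n ≤ k := by
  obtain ⟨f, hf⟩ := hU
  obtain ⟨t, rfl⟩ := I.subschemeι_app_surjective U f
  have ht : t ∈ I.radical.ideal U := by
    rw [← ker_inclusion_app_comp_subschemeι_app I.le_radical]
    exact hf.map_self
  have : Nonempty ↥(redIncl I ⁻¹ᵁ I.subschemeι ⁻¹ᵁ U.1) :=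
    ⟨⟨c, mem_subschemeι_preimage_of_mem I.le_radical hcU⟩⟩
  refine hf.le_of_pow_eq_zero ?_
  rw [← map_pow, subschemeι_app_eq_zero_iff]
  refine hk U ?_
  rw [Scheme.IdealSheafData.ideal_pow, Pi.pow_apply]
  exact Ideal.pow_mem_pow ht k

end HasParameter

section Multiplicity

variable {n : ℕ} [NeZero n] (h : ∀ c : I.radical.subscheme, ∃ U : X.affineOpens,
  I.radical.subschemeι c ∈ U.1 ∧ HasParameter I U n)

include h in
lemma radical_pow_le_of_hasParameter : I.radical ^ n ≤ I := by
  intro U s hs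
  rw [Scheme.IdealSheafData.ideal_pow, Pi.pow_apply] at hs
  rw [← subschemeι_app_eq_zero_iff]
  refine TopCat.Presheaf.section_ext I.subscheme.sheaf _ _ 0 fun y hy => ?_
  obtain ⟨c, rfl⟩ := redIncl_bijective.2 y
  obtain ⟨V, hcV, hV⟩ := h c
  obtain ⟨f, hf⟩ := hV.exists_stalk hcV
  let φ : Γ(X, U.1) →+* I.subscheme.presheaf.stalk (redIncl I c) :=
    (I.subscheme.presheaf.germ (I.subschemeι ⁻¹ᵁ U.1) (redIncl I c) hy).hom.comp
      (I.subschemeι.app U.1).hom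
  have h_map : (I.radical.ideal U).map φ ≤ Ideal.span {f} := by
    rw [Ideal.map_le_iff_le_comap, ← hf.ker_eq_span, RingHom.comap_ker,
      ← ker_inclusion_app_comp_subschemeι_app I.le_radical]
    intro t ht
    change (redIncl I).stalkMap c (I.subscheme.presheaf.germ (I.subschemeι ⁻¹ᵁ U.1)
      (redIncl I c) hy (I.subschemeι.app U.1 t)) = 0
    rw [Scheme.Hom.germ_stalkMap_apply]
    exact (congrArg _ ht).trans (map_zero _)
  have h_pow : φ s ∈ Ideal.span {f} ^ n :=
    Ideal.pow_right_mono h_map n (Ideal.map_pow φ _ n ▸ Ideal.mem_map_of_mem φ hs)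
  rw [Ideal.span_singleton_pow, hf.pow_eq_zero, Ideal.mem_span_singleton, zero_dvd_iff] at h_pow
  exact h_pow.trans (map_zero _).symm

include h in
theorem isMultiplicity_of_hasParameter [Nonempty I.radical.subscheme] : IsMultiplicity I n := by
  obtain ⟨c⟩ := ‹Nonempty I.radical.subscheme›
  obtain ⟨U, hcU, hU⟩ := h c
  exact ⟨radical_pow_le_of_hasParameter h, fun k hk => hU.le_of_radical_pow_le hcU hk⟩

end Multiplicity

namespace IsPrimitiveMultipleCurve

lemma exists_maximalIdeal_stalk_eq_span_pair (hI : IsPrimitiveMultipleCurve π I)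
    {y : I.subscheme} (hy : IsClosed {y}) :
    ∃ u v, IsLocalRing.maximalIdeal (I.subscheme.presheaf.stalk y) = Ideal.span {u, v} := by
  have hy_closed : IsClosed {I.subschemeι y} := by
    rw [← Set.image_singleton]
    exact I.subschemeι.isClosedEmbedding.isClosedMap _ hy
  obtain ⟨J, W, hyW, hJ, hJI⟩ := hI.surface _ (subschemeι_mem_support y) hy_closed
  obtain ⟨x, hx⟩ := exists_maximalIdeal_stalk_subscheme_eq_span hJ hJI hyW hy
  refine ⟨x 0, x 1, hx.trans (congrArg Ideal.span ?_)⟩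
  ext z
  simp [eq_comm]

lemma exists_maximalIdeal_stalk_eq_span_singleton (hI : IsPrimitiveMultipleCurve π I)
    {c : I.radical.subscheme} (hc : IsClosed {c}) :
    ∃ t, IsLocalRing.maximalIdeal (I.radical.subscheme.presheaf.stalk c) = Ideal.span {t} ∧
      ¬IsNilpotent t := by
  obtain ⟨x, hx, hx_reg⟩ := exists_maximalIdeal_stalk_eq_span hI.smooth hc
  refine ⟨x 0, ?_, fun ⟨k, hk⟩ => ?_⟩
  · rw [hx, Set.range_unique]
    rfl
  · exact one_ne_zero (((hx_reg 0).pow k).right_eq_zero_of_smul (x := 1) (by rw [hk, zero_smul]))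

lemma exists_isTruncatedParameter_stalkMap (hI : IsPrimitiveMultipleCurve π I)
    {c : I.radical.subscheme} (hc : IsClosed {c}) :
    ∃ f n, n ≠ 0 ∧ IsTruncatedParameter ((redIncl I).stalkMap c).hom f n := by
  have hc_closed : IsClosed {redIncl I c} := by
    rw [← Set.image_singleton]
    exact (redIncl I).isClosedEmbedding.isClosedMap _ hc
  have hCM := hI.cohenMacaulay (redIncl I c)
  have := hCM.1
  have h_surj : Function.Surjective ((redIncl I).stalkMap c).hom :=
    (redIncl I).stalkMap_surjective c
  obtain ⟨t, ht, ht_nil⟩ := hI.exists_maximalIdeal_stalk_eq_span_singleton hc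
  obtain ⟨u, v, huv⟩ := hI.exists_maximalIdeal_stalk_eq_span_pair hc_closed
  obtain ⟨w, rfl⟩ := h_surj t
  have hw : w ∈ IsLocalRing.maximalIdeal (I.subscheme.presheaf.stalk (redIncl I c)) := by
    rw [← IsLocalRing.maximalIdeal_comap ((redIncl I).stalkMap c).hom, Ideal.mem_comap, ht]
    exact Ideal.mem_span_singleton_self _
  obtain ⟨r, hr, hr_reg⟩ := hCM.exists_isSMulRegular hw fun h => ht_nil (h.map _)
  exact exists_isTruncatedParameter_of_isLocalRing h_surj
    (fun a ha => isNilpotent_of_stalkMap_eq_zero (redIncl I) redIncl_bijective.2 c ha)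
    ht ht_nil huv hr hr_reg

end IsPrimitiveMultipleCurve

lemma exists_hasParameter_of_stalkMap [IsLocallyNoetherian I.subscheme] {c : I.radical.subscheme}
    {f : I.subscheme.presheaf.stalk (redIncl I c)} {n : ℕ}
    (hf : IsTruncatedParameter ((redIncl I).stalkMap c).hom f n) :
    ∃ U : X.affineOpens, I.radical.subschemeι c ∈ U.1 ∧ HasParameter I U n := by
  obtain ⟨_, ⟨U, hU, rfl⟩, hcU, -⟩ := X.isBasis_affineOpens.exists_subset_of_mem_open
    (Set.mem_univ (I.subschemeι (redIncl I c))) isOpen_univ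
  have h_affine : IsAffineOpen (I.subschemeι ⁻¹ᵁ U) := hU.preimage _
  have : IsNoetherianRing Γ(I.subscheme, I.subschemeι ⁻¹ᵁ U) :=
    IsLocallyNoetherian.component_noetherian ⟨_, h_affine⟩
  obtain ⟨g, hcg, hg⟩ := exists_isTruncatedParameter_basicOpen (redIncl I) h_affine c hcU hf
  obtain ⟨g, rfl⟩ := I.subschemeι_app_surjective ⟨U, hU⟩ g
  refine ⟨⟨X.basicOpen g, hU.basicOpen g⟩, ?_, ?_⟩
  · rw [← Scheme.preimage_basicOpen] at hcg
    rw [← subschemeι_redIncl]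
    exact hcg
  · rw [HasParameter, Scheme.preimage_basicOpen]
    exact hg

namespace IsPrimitiveMultipleCurve

variable [IsLocallyNoetherian I.subscheme]

lemma exists_hasParameter (hI : IsPrimitiveMultipleCurve π I) (c : I.radical.subscheme) :
    ∃ n ≠ 0, ∃ U : X.affineOpens, I.radical.subschemeι c ∈ U.1 ∧ HasParameter I U n := by
  have := hI.smooth.smooth
  have : JacobsonSpace I.radical.subscheme :=
    LocallyOfFiniteType.jacobsonSpace (subStr π I.radical)
  obtain ⟨c', hc', hc'_closed⟩ := nonempty_inter_closedPoints (Z := closure {c})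
    ⟨c, subset_closure rfl⟩ isClosed_closure.isLocallyClosed
  obtain ⟨f, n, hn, hf⟩ := hI.exists_isTruncatedParameter_stalkMap hc'_closed
  obtain ⟨U, hcU, hU⟩ := exists_hasParameter_of_stalkMap hf
  have h_spec : c ⤳ c' := specializes_iff_mem_closure.mpr hc'
  exact ⟨n, hn, U, (h_spec.map I.radical.subschemeι.continuous).mem_open U.1.2 hcU, hU⟩

theorem exists_forall_hasParameter (hI : IsPrimitiveMultipleCurve π I) :
    ∃ n ≠ 0, ∀ c : I.radical.subscheme, ∃ U : X.affineOpens,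
      I.radical.subschemeι c ∈ U.1 ∧ HasParameter I U n := by
  have := hI.connected
  choose n hn U hcU hU using hI.exists_hasParameter
  have (c : I.radical.subscheme) : NeZero (n c) := ⟨hn c⟩
  have h_const : IsLocallyConstant n := by
    rw [IsLocallyConstant.iff_exists_open]
    exact fun c => ⟨I.radical.subschemeι ⁻¹ᵁ (U c).1, (I.radical.subschemeι ⁻¹ᵁ (U c).1).2, hcU c,
      fun c' hc' => (hU c').eq (hU c) (hcU c') hc'⟩
  obtain ⟨c₀⟩ : Nonempty I.radical.subscheme := inferInstance
  refine ⟨n c₀, hn c₀, fun c => ⟨U c, hcU c, ?_⟩⟩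
  rw [h_const.apply_eq_of_preconnectedSpace c₀ c]
  exact hU c

theorem exists_isAbstractPrimitiveCurve (hI : IsPrimitiveMultipleCurve π I) :
    ∃ (n : ℕ) (_ : NeZero n), IsMultiplicity I n ∧
      IsAbstractPrimitiveCurve (subStr π I) (redIncl I) n := by
  obtain ⟨n, hn, h⟩ := hI.exists_forall_hasParameter
  have := hI.connected
  have : NeZero n := ⟨hn⟩
  have : Smooth (subStr π I.radical) := hI.smooth.smooth
  refine ⟨n, ⟨hn⟩, isMultiplicity_of_hasParameter h,
    isAbstractPrimitiveCurve_of_forall_isProductOver redIncl_bijective fun c => ?_⟩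
  obtain ⟨U, hcU, hU⟩ := h c
  exact ⟨_, mem_subschemeι_preimage_of_mem I.le_radical hcU, hU.isProductOver⟩

end IsPrimitiveMultipleCurve

end Reduced

end PrimitiveCurves

theorem mainTheorem3_general :
    (∀ (X : Scheme.{0}) (π : X ⟶ SpecC) (I : X.IdealSheafData), IsSmoothHypersurface π I →
      ∀ (n : ℕ) [NeZero n] (P : I.subscheme),
        (∃ σ : LocalRingAt (subStr π I) P →ₐ[ℂ] LocalRingAt (subStr π (I ^ n)) (thickIncl I n P),
          ∀ a, restriction π I n P (σ a) = a) ∧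
        (∀ σ : LocalRingAt (subStr π I) P →ₐ[ℂ] LocalRingAt (subStr π (I ^ n)) (thickIncl I n P),
          (∀ a, restriction π I n P (σ a) = a) →
          ∃ e : (LocalRingAt (subStr π I) P ⊗[ℂ] TruncPoly n) ≃ₐ[ℂ]
              LocalRingAt (subStr π (I ^ n)) (thickIncl I n P),
            (∀ a, e (a ⊗ₜ 1) = σ a) ∧ restriction π I n P (e (1 ⊗ₜ TruncPoly.t n)) = 0) ∧
        (∃ V : (I ^ n).subscheme.Opens, thickIncl I n P ∈ V ∧
          ∃ e : V.toScheme ≅ prodZ ((thickIncl I n ⁻¹ᵁ V).ι ≫ subStr π I) n,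
            e.hom ≫ prodZ.str _ n = V.ι ≫ subStr π (I ^ n) ∧
            (thickIncl I n ∣_ V) ≫ e.hom = prodZ.zero _ n)) ∧
    (∀ (X : Scheme.{0}) (π : X ⟶ SpecC) (I : X.IdealSheafData), IsLocallyNoetherian I.subscheme →
      IsPrimitiveMultipleCurve π I →
      ∃ (n : ℕ) (_ : NeZero n), IsMultiplicity I n ∧
        IsAbstractPrimitiveCurve (subStr π I)
          (Scheme.IdealSheafData.inclusion I.le_radical) n) := by
  refine ⟨fun X π I hI n _ P => ⟨hI.exists_section_restriction n P,
    fun σ hσ => hI.exists_algEquiv_of_section n hσ, ?_⟩,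
    fun X π I _ hI => hI.exists_isAbstractPrimitiveCurve⟩
  obtain ⟨V, hPV, hV⟩ := hI.exists_isProductOver n P
  have h_str : thickIncl I n ≫ subStr π (I ^ n) = subStr π I := by simp
  rw [IsProductOver, h_str] at hV
  exact ⟨V, hPV, hV⟩

theorem mainTheorem3 :
    (∀ (X : Scheme.{0}) (π : X ⟶ SpecC), IsSmoothVariety π → IrreducibleSpace X →
      ∀ I : X.IdealSheafData, IsSmoothHypersurface π I →
      ∀ (n : ℕ) [NeZero n] (P : I.subscheme),
        (∃ σ : LocalRingAt (subStr π I) P →ₐ[ℂ] LocalRingAt (subStr π (I ^ n)) (thickIncl I n P),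
          ∀ a, restriction π I n P (σ a) = a) ∧
        (∀ σ : LocalRingAt (subStr π I) P →ₐ[ℂ] LocalRingAt (subStr π (I ^ n)) (thickIncl I n P),
          (∀ a, restriction π I n P (σ a) = a) →
          ∃ e : (LocalRingAt (subStr π I) P ⊗[ℂ] TruncPoly n) ≃ₐ[ℂ]
              LocalRingAt (subStr π (I ^ n)) (thickIncl I n P),
            (∀ a, e (a ⊗ₜ 1) = σ a) ∧ restriction π I n P (e (1 ⊗ₜ TruncPoly.t n)) = 0) ∧
        (∃ V : (I ^ n).subscheme.Opens, thickIncl I n P ∈ V ∧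
          ∃ e : V.toScheme ≅ prodZ ((thickIncl I n ⁻¹ᵁ V).ι ≫ subStr π I) n,
            e.hom ≫ prodZ.str _ n = V.ι ≫ subStr π (I ^ n) ∧
            (thickIncl I n ∣_ V) ≫ e.hom = prodZ.zero _ n)) ∧
    (∀ (X : Scheme.{0}) (π : X ⟶ SpecC), IsSmoothVariety π → SmoothOfRelativeDimension 3 π →
      ConnectedSpace X → ∀ I : X.IdealSheafData, IsPrimitiveMultipleCurve π I →
      ∃ (n : ℕ) (_ : NeZero n), IsMultiplicity I n ∧
        IsAbstractPrimitiveCurve (subStr π I)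
          (Scheme.IdealSheafData.inclusion I.le_radical) n) :=
  ⟨fun X π _ _ => mainTheorem3_general.1 X π, fun X π hX _ _ I => have := hX.finiteType
    mainTheorem3_general.2 X π I (LocallyOfFiniteType.isLocallyNoetherian (subStr π I))⟩
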